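/- **Setting.** Let $\mathcal A$ be a finite alphabet with $d\ge 2$ letters, $\pi=(\pi_t,\pi_b)$ an irreducible pair of bijections $\mathcal A\to\{1,\dots,d\}$, and $\tau\in\Theta_\pi$ a suspension vector, i.e. $\sum_{\pi_t(\alpha)<k}\tau_\alpha>0>\sum_{\pi_b(\alpha)<k}\tau_\alpha$ for $1<k\le d$. Let $\Omega_\pi$ be the antisymmetric matrix with $(\Omega_\pi)_{\alpha\beta}=1$ if $\pi_t(\alpha)<\pi_t(\beta)$ and $\pi_b(\alpha)>\pi_b(\beta)$, $-1$ if both inequalities are reversed, and $0$ otherwise, and let $q=q(\pi,\tau)=-\Omega_\pi\tau$ be the (positive) vector of heights. Let $\lambda\in(0,\infty)^{\mathcal A}$. The backward Rauzy–Veech algorithm starts from $(\pi^{(0)},\lambda^{(0)},\tau^{(0)})=(\pi,\lambda,\tau)$. For $n\le 0$ with $\sum_\alpha\tau^{(n)}_\alpha<0$ (resp. $>0$), $\pi^{(n-1)}$ is the origin of the arrow of top (resp. bottom) type of the Rauzy diagram ending at $\pi^{(n)}$; the winner $w$ of this arrow is the last top (resp. bottom) letter of $\pi^{(n-1)}$ and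 the loser $\ell$ is its last bottom (resp. top) letter; $\lambda^{(n-1)}_w=\lambda^{(n)}_w+\lambda^{(n)}_\ell$ and $\tau^{(n-1)}_w=\tau^{(n)}_w+\tau^{(n)}_\ell$, the other components being unchanged. The matrix of this arrow is $B(n-1,n)=\mathbb I+E_{\ell w}$, and $B(m,n)=B(n-1,n)\cdots B(m,m+1)$ for $m\le n\le0$. The arrows and matrices depend only on $(\pi,\tau)$. Let $\|B\|$ denote the sum of the absolute values of the entries of $B$. For $n\le 0$ let $|Z(n)|$ (Zorich time) be the number of maximal blocks of consecutive arrows of the same type in the path from time $n$ to time $0$. $(\pi,\tau)$ is of *(weak) dual Roth type* if the algorithm never stops (the sums $\sum_\alpha\tau^{(n)}_\alpha$ never vanish), the resulting backward path is a concatenation of infinitely many complete paths (a finite path is complete if every letter wins at least one of its arrows), and * (a) with $\hat n_0=0$ and $\hat n_{k-1}$ the largest integer $n<\hat n_k$ such that the path from time $n$ to time $\hat n_k$ is complete, for every $\varepsilon>0$ there is $C_0>0$ with $\|B(\hat n_{k-1},\hat n_k)\|\le C_0\|B(\hat n_k,0)\|^{\varepsilon}$ for all $k\le 0$; * (b) there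 are $\theta>0$, $C_1>0$ such that for all $n\le0$ the restriction of ${}^tB(n,0)$ to the hyperplane $\{v\in\mathbb R^{\mathcal A}:\sum_\alpha q_\alpha v_\alpha=0\}$ has operator norm at most $C_1\|B(n,0)\|^{1-\theta}$. For $\chi\in\mathbb R^{\mathcal A}$ and $n\le 0$ put $\chi^{(n)}=B(n,0)^{-1}\chi$. Call $\chi$ *subpolynomially deviating in the past* if $\limsup_{n\to-\infty}\frac1{|Z(n)|}\log\|\chi^{(n)}\|\le0$; at an Oseledets-generic point this holds for every $\chi$ in the central Oseledets space of the Kontsevich–Zorich cocycle. For $n\le0$ let $T^{(n)}$ be the interval exchange map with data $(\pi^{(n)},\lambda^{(n)})$, exchanging the intervals $I^{(n)}_\beta$, and let $q^{(n)}=-\Omega_{\pi^{(n)}}\tau^{(n)}$. For $\alpha\in\mathcal A$ put $B_\alpha(n,0)=\sum_\beta B(n,0)_{\alpha\beta}$; for $0\le j<B_\alpha(n,0)$ let $\beta(\alpha,j)$ be the letter with $(T^{(n)})^j(I^{(0)}_\alpha)\subset I^{(n)}_{\beta(\alpha,j)}$; let $Sq(\ell)=\sum_{0\le j<\ell}q^{(n)}_{\beta(\alpha,j)}$.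 Let $\Omega^{(n)}_\alpha$ be the continuous function on $[0,q_\alpha]$ that is affine on each $[Sq(\ell),Sq(\ell+1)]$, satisfies $\Omega^{(n)}_\alpha(Sq(\ell+1))-\Omega^{(n)}_\alpha(Sq(\ell))=\chi^{(n)}_{\beta(\alpha,\ell)}$ for $0\le \ell<B_\alpha(n,0)$, and has mean $0$ on $[0,q_\alpha]$. **Theorem.** Assume that $(\pi,\tau)$ is of (weak) dual Roth type, and let $\eta\in(0,1)$. There is $\delta>0$, depending only on $(\pi,\tau)$ and $\eta$, and for every $\chi$ that is subpolynomially deviating in the past there is $C>0$, depending only on $(\pi,\tau),\eta,\chi$, such that for every $\lambda\in(0,\infty)^{\mathcal A}$, every $\alpha\in\mathcal A$ and every $\eta$-Hölder function $\psi$ on $[0,q_\alpha]$ with $\int_0^{q_\alpha}\psi=0$: 1. the sequence $\int_0^{q_\alpha}\psi(x)\,\Omega^{(n)}_\alpha(x)\,dx$ converges to a real limit as $n\to-\infty$; 2. for all $n'\le n\le0$, $$\left|\int_0^{q_\alpha}\psi(x)\bigl(\Omega^{(n')}_\alpha(x)-\Omega^{(n)}_\alpha(x)\bigr)dx\right|\le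 C\,\|\psi\|_{C^\eta}\,\|B(n,0)\|^{-\delta/4},$$ where $\|\psi\|_{C^\eta}=\sup|\psi|+\sup_{x\ne y}|\psi(x)-\psi(y)|/|x-y|^\eta$. -/

import Mathlib

open Set Filter Topology MeasureTheory
open scoped NNReal Matrix

noncomputable section

namespace RauzyVeech

universe u

/-! ### Combinatorial data

The alphabet is a finite type `A` with at least two letters and `d = Fintype.card A`.
Positions are numbered `0, …, d - 1`. -/

/-- A pair of bijections from the alphabet onto the `d` positions (top and bottom rows). -/
structure CombData (A : Type u) [Fintype A] where
  top : A ≃ Fin (Fintype.card A)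
  bot : A ≃ Fin (Fintype.card A)

variable {A : Type u} [Fintype A] [Nontrivial A]

/-- The last position `d - 1`. -/
def lastPos (A : Type u) [Fintype A] [Nontrivial A] : Fin (Fintype.card A) :=
  ⟨Fintype.card A - 1, Nat.sub_lt Fintype.card_pos Nat.one_pos⟩

namespace CombData

/-- For `1 ≤ k < d`, the first `k` letters of the two rows form different sets. -/
def Irreducible (p : CombData A) : Prop :=
  ∀ k : ℕ, 1 ≤ k → k < Fintype.card A →
    {a : A | (p.top a : ℕ) < k} ≠ {a : A | (p.bot a : ℕ) < k}

/-- The last letter of the top row. -/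
def lastTop (p : CombData A) : A := p.top.symm (lastPos A)

/-- The last letter of the bottom row. -/
def lastBot (p : CombData A) : A := p.bot.symm (lastPos A)

/-- The antisymmetric matrix `Ω_π`. -/
def Om (p : CombData A) : Matrix A A ℝ := Matrix.of fun a b =>
  if p.top a < p.top b ∧ p.bot b < p.bot a then 1
  else if p.top b < p.top a ∧ p.bot a < p.bot b then -1
  else 0

end CombData

/-- The permutation of positions that fixes `0, …, k`, sends the last position to `k + 1`
and every other position `x > k` to `x + 1`. -/
def tailCycle (d k : ℕ) : Equiv.Perm (Fin d) where
  toFun x := ⟨if (x : ℕ) ≤ k then x else if (x : ℕ) = d - 1 then k + 1 else x + 1, by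
    have := x.2
    split_ifs <;> omega⟩
  invFun x := ⟨if (x : ℕ) ≤ k then x else if (x : ℕ) = k + 1 then d - 1 else x - 1, by
    have := x.2
    split_ifs <;> omega⟩
  left_inv x := by
    have := x.2
    apply Fin.ext
    dsimp only
    split_ifs <;> omega
  right_inv x := by
    have := x.2
    apply Fin.ext
    dsimp only
    split_ifs <;> omega

namespace CombData

/-- `R_t`: the last letter of the bottom row is moved to the place right after
the last top letter (in the bottom row). -/
def Rt (p : CombData A) : CombData A :=
  ⟨p.top, p.bot.trans (tailCycle _ (p.bot p.lastTop))⟩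

/-- `R_b`: the last letter of the top row is moved to the place right after
the last bottom letter (in the top row). -/
def Rb (p : CombData A) : CombData A :=
  ⟨p.top.trans (tailCycle _ (p.top p.lastBot)), p.bot⟩

/-- `R_t⁻¹`: in the bottom row, the letter right after the last top letter is moved to the end. -/
def RtInv (p : CombData A) : CombData A :=
  ⟨p.top, p.bot.trans (tailCycle _ (p.bot p.lastTop)).symm⟩

/-- `R_b⁻¹`: in the top row, the letter right after the last bottom letter is moved to the end. -/
def RbInv (p : CombData A) : CombData A :=
  ⟨p.top.trans (tailCycle _ (p.top p.lastBot)).symm, p.bot⟩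

theorem Rt_RtInv (p : CombData A) : p.RtInv.Rt = p := by
  have h : p.RtInv.bot p.RtInv.lastTop = p.bot p.lastTop := by
    apply Fin.ext
    simp [RtInv, lastTop, tailCycle]
  unfold Rt
  rw [h]
  cases p
  simp [RtInv, Equiv.trans_assoc]

theorem Rb_RbInv (p : CombData A) : p.RbInv.Rb = p := by
  have h : p.RbInv.top p.RbInv.lastBot = p.top p.lastBot := by
    apply Fin.ext
    simp [RbInv, lastBot, tailCycle]
  unfold Rb
  rw [h]
  cases p
  simp [RbInv, Equiv.trans_assoc]

end CombData

/-! ### Suspension data and the backward algorithm -/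

/-- A pair `(π, τ)`. -/
structure SuspData (A : Type u) [Fintype A] where
  comb : CombData A
  tau : A → ℝ

namespace SuspData

/-- `τ` is a suspension vector for `π`, that is `τ ∈ Θ_π`. -/
def IsSuspension (s : SuspData A) : Prop :=
  ∀ k : ℕ, 1 ≤ k → k < Fintype.card A →
    0 < ∑ a with (s.comb.top a : ℕ) < k, s.tau a ∧
      ∑ a with (s.comb.bot a : ℕ) < k, s.tau a < 0

/-- The heights `q = - Ω_π τ` of the zippered rectangles. -/
def height (s : SuspData A) : A → ℝ := -(s.comb.Om *ᵥ s.tau)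

/-- The backward step is the inverse of a top step; it is the inverse of a bottom step if the
sum is positive, and the algorithm stops if the sum vanishes (excluded in `DualRoth`). -/
def IsTop (s : SuspData A) : Prop := ∑ a, s.tau a < 0

open Classical in
/-- The origin of the arrow of the Rauzy diagram that the backward step at `(π, τ)` adds. -/
def prevComb (s : SuspData A) : CombData A :=
  if s.IsTop then s.comb.RtInv else s.comb.RbInv

open Classical in
/-- The winner of that arrow. -/
def winner (s : SuspData A) : A :=
  if s.IsTop then s.prevComb.lastTop else s.prevComb.lastBot

open Classical in
/-- The loser of that arrow. -/
def loser (s : SuspData A) : A :=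
  if s.IsTop then s.prevComb.lastBot else s.prevComb.lastTop

variable [DecidableEq A]

/-- The matrix `B_γ = 1 + E_{loser, winner}` of that arrow. -/
def arrowMatrix (s : SuspData A) : Matrix A A ℕ := 1 + Matrix.single s.loser s.winner 1

/-- One step of the backward Rauzy–Veech algorithm. -/
def backStep (s : SuspData A) : SuspData A :=
  ⟨s.prevComb, Function.update s.tau s.winner (s.tau s.winner + s.tau s.loser)⟩

/-- `s.back N` is `(π^{(-N)}, τ^{(-N)})`; negative times are indexed by `N = -n`. -/
def back (s : SuspData A) : ℕ → SuspData A
  | 0 => s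
  | N + 1 => (s.back N).backStep

/-- The length vector `λ^{(-N)}` of the backward algorithm started at `(π, λ, τ)`. -/
def backLen (s : SuspData A) (len : A → ℝ) : ℕ → A → ℝ
  | 0 => len
  | N + 1 => Function.update (s.backLen len N) (s.back N).winner
      (s.backLen len N (s.back N).winner + s.backLen len N (s.back N).loser)

/-- `s.B M N` is the matrix `B(-M, -N)`, for `N ≤ M`: the product of the arrow matrices along the
path from `π^{(-M)}` to `π^{(-N)}`, the last arrow being the leftmost factor. -/
def B (s : SuspData A) (M N : ℕ) : Matrix A A ℕ :=
  ((List.range' N (M - N)).map fun i => (s.back i).arrowMatrix).prod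

/-- The Zorich time `|Z(-N)|`: the number of maximal blocks of arrows of the same type
in the path from time `-N` to time `0`. -/
def zorichTime (s : SuspData A) : ℕ → ℕ
  | 0 => 0
  | 1 => 1
  | N + 2 => s.zorichTime (N + 1) +
      open Classical in if ((s.back N).IsTop ↔ (s.back (N + 1)).IsTop) then 0 else 1

/-- The path from time `-M` to time `-N` is complete: each letter wins at least once. -/
def Complete (s : SuspData A) (M N : ℕ) : Prop :=
  ∀ a : A, ∃ i, N ≤ i ∧ i < M ∧ (s.back i).winner = a

/-- The backward rotation number is the concatenation of infinitely many complete paths. -/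
def InfinitelyComplete (s : SuspData A) : Prop :=
  ∃ t : ℕ → ℕ, StrictMono t ∧ t 0 = 0 ∧ ∀ k, s.Complete (t (k + 1)) (t k)

/-- The accelerated times: `s.accTime k` is `- n̂_{-k}`. -/
def accTime (s : SuspData A) : ℕ → ℕ
  | 0 => 0
  | k + 1 => sInf {M : ℕ | s.accTime k < M ∧ s.Complete M (s.accTime k)}

end SuspData

variable [DecidableEq A]

/-- The norm of a matrix: the sum of its (nonnegative) entries. -/
def matNorm (X : Matrix A A ℕ) : ℝ := ((∑ a, ∑ b, X a b : ℕ) : ℝ)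

/-- (Weak) dual Roth type. In the spectral gap condition, the hyperplane consists of the functions
on `⊔ (0, q_α)`, constant on each interval, whose integral vanishes; `ᵗB_0(n, 0)` is the
restriction of `ᵗB(n, 0)` to it, and its operator norm is bounded. -/
structure DualRoth (s : SuspData A) : Prop where
  irreducible : s.comb.Irreducible
  suspension : s.IsSuspension
  infinite : ∀ N, ∑ a, (s.back N).tau a ≠ 0
  complete : s.InfinitelyComplete
  growth : ∀ ε : ℝ, 0 < ε → ∃ C : ℝ, 0 < C ∧ ∀ k : ℕ,
    matNorm (s.B (s.accTime (k + 1)) (s.accTime k)) ≤ C * matNorm (s.B (s.accTime k) 0) ^ ε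
  gap : ∃ θ : ℝ, 0 < θ ∧ ∃ C : ℝ, 0 < C ∧ ∀ N : ℕ, ∀ v : A → ℝ,
    ∑ a, s.height a * v a = 0 →
      ‖((s.B N 0).map (Nat.cast : ℕ → ℝ))ᵀ *ᵥ v‖ ≤ C * matNorm (s.B N 0) ^ (1 - θ) * ‖v‖

/-! ### Interval exchange maps -/

/-- Left endpoint of the interval `I_α` of the top partition (the domain starts at `0`). -/
def leftEnd (p : CombData A) (len : A → ℝ) (a : A) : ℝ := ∑ b with p.top b < p.top a, len b

/-- The exchanged open interval `I_α`. -/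
def exchInt (p : CombData A) (len : A → ℝ) (a : A) : Set ℝ :=
  Ioo (leftEnd p len a) (leftEnd p len a + len a)

open Classical in
/-- The interval exchange map: translation by `(Ω_π λ)_α` on `I_α`, extended by right-continuity
to the left endpoint (and by the identity outside of its domain). -/
def iem (p : CombData A) (len : A → ℝ) (x : ℝ) : ℝ :=
  x + ∑ a, if x ∈ Ico (leftEnd p len a) (leftEnd p len a + len a) then (p.Om *ᵥ len) a else 0

/-! ### The piecewise affine graphs of central Birkhoff sums -/

namespace SuspData

/-- The letter `β(α, j)` with `(T^{(-N)})^j (I_α^{(0)}) ⊆ I_β^{(-N)}`, where `T^{(-N)}` is the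
interval exchange map with data `(π^{(-N)}, λ^{(-N)})`. -/
def visit (s : SuspData A) (len : A → ℝ) (N : ℕ) (a : A) (j : ℕ) : A :=
  Classical.epsilon fun b : A =>
    MapsTo ((iem (s.back N).comb (s.backLen len N))^[j])
      (exchInt s.comb len a) (exchInt (s.back N).comb (s.backLen len N) b)

/-- The return time `B_α(-N, 0)`. -/
def retTime (s : SuspData A) (N : ℕ) (a : A) : ℕ := ∑ b, s.B N 0 a b

/-- `χ^{(-N)} = B(-N, 0)⁻¹ χ`. -/
def pull (s : SuspData A) (χ : A → ℝ) (N : ℕ) : A → ℝ :=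
  ((s.B N 0).map (Nat.cast : ℕ → ℝ))⁻¹ *ᵥ χ

/-- `χ` is central in the past: `χ^{(n)}` grows subexponentially in Zorich time as `n → -∞`,
that is `limsup (1 / |Z(n)|) log ‖χ^{(n)}‖ ≤ 0`. -/
def IsCentral (s : SuspData A) (χ : A → ℝ) : Prop :=
  ∀ ε : ℝ, 0 < ε → ∃ C : ℝ, ∀ N : ℕ, ‖s.pull χ N‖ ≤ C * Real.exp (ε * s.zorichTime N)

end SuspData

/-- The continuous piecewise affine function with value `0` at `0` which on the `j`-th of `K`
consecutive intervals, of length `len j`, is affine with total increment `inc j`. -/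
def pwAffine (K : ℕ) (len inc : ℕ → ℝ) (x : ℝ) : ℝ :=
  ∑ j ∈ Finset.range K,
    inc j * max 0 (min 1 ((x - ∑ i ∈ Finset.range j, len i) / len j))

namespace SuspData

/-- The graph of the Birkhoff sums of `χ^{(-N)}` over `I_α^{(0)}`, starting from the value `0`:
its `j`-th affine piece has length `q^{(-N)}_{β(α,j)}` and increment `χ^{(-N)}_{β(α,j)}`. -/
def sumGraph (s : SuspData A) (len χ : A → ℝ) (N : ℕ) (a : A) : ℝ → ℝ :=
  pwAffine (s.retTime N a) (fun j => (s.back N).height (s.visit len N a j))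
    (fun j => s.pull χ N (s.visit len N a j))

/-- The function `Ω_α^{(-N)}`: the graph above, shifted to have mean `0` on `[0, q_α]`. -/
def OmegaGraph (s : SuspData A) (len χ : A → ℝ) (N : ℕ) (a : A) (x : ℝ) : ℝ :=
  s.sumGraph len χ N a x -
    (s.height a)⁻¹ * ∫ y in (0 : ℝ)..(s.height a), s.sumGraph len χ N a y

end SuspData

/-- The norm `‖ψ‖_{C^η}` on the interval `[0, q]`. -/
def holderNorm (η : ℝ≥0) (q : ℝ) (ψ : ℝ → ℝ) : ℝ :=
  (⨆ x : Icc (0 : ℝ) q, |ψ x|) + (nnHolderNorm η ((Icc (0 : ℝ) q).domRestrict ψ) : ℝ)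

end RauzyVeech

end

/-! Write `x_N` for the norm of `B(-N, 0)` and `d` for the number of letters. The itinerary of `I_α`
at time `-N` is a word obtained by iterated substitution, and it does not depend on `λ` (`visit_eq`,
`sumGraph_eq`); this gives uniformity in `λ`. One backward step cuts every piece of the loser in two
and leaves the other pieces alone. Hence the graph changes by a sum of translates of a single bump,
one for each occurrence of the loser (`wordGraph_succ_sub`). Integrated against `ψ`, the change is
the integral over one piece of the bump times the sum of translates of `ψ` over these occurrences
(`integral_mul_occSum`).

Three factors are then bounded. The bump is at most a multiple of the norm of `χ^{(-N-1)}`, hence of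
any small power of `x_N`, because Zorich time is at most logarithmic in `x_N` (`exp_zorichTime_le`,
`exists_norm_pull_le`). The piece has length at most a multiple of `x_N ^ (ε - 1)`, because the
columns of `B(-N, 0)` are balanced up to small powers (`exists_norm_le_colSum`, `exists_height_le`).
The sum over occurrences is at most a multiple of `x_N ^ (1 - δ)` (`exists_abs_occSum_le`): at a
coarser time `-M` the function `ψ` is replaced by its averages over pieces, with a Hölder error; the
averages form a vector `ᵗB(-M, 0) f` with `f` orthogonal to the heights since `ψ` has mean zero, and
the spectral gap applies to `f`. Taking `x_M` close to a small power of `x_N` balances the two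
errors.

A step therefore costs at most a multiple of `x_N ^ (-δ/2)`. Such terms are summable over all steps,
without acceleration: `x_{N+1} - x_N` is a column sum, almost as large as `x_N`, so each term is
dominated by a difference of consecutive values of `x_N ^ (-δ/4)` (`exists_rpow_le_sub`), and the
sum telescopes. -/

noncomputable section

namespace RauzyVeech

/-! ### Rows of a pair of bijections -/

section Rows

variable {A : Type*} [Fintype A]

/-- The sum of `f` over the letters placed before `b` in the row `e`. -/
def rowSum (e : A ≃ Fin (Fintype.card A)) (f : A → ℝ) (b : A) : ℝ :=
  ∑ c with e c < e b, f c

theorem rowSum_eq_sum_ite (e : A ≃ Fin (Fintype.card A)) (f : A → ℝ) (b : A) :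
    rowSum e f b = ∑ c, if e c < e b then f c else 0 := by
  rw [rowSum, Finset.sum_filter]

/-- The row `e'` is obtained from `e` by moving to the end the letter `l` placed just after `w`. -/
structure MovesToEnd (e e' : A ≃ Fin (Fintype.card A)) (w l : A) : Prop where
  ne : w ≠ l
  source : (e l : ℕ) = e w + 1
  target : (e' l : ℕ) = Fintype.card A - 1
  other : ∀ c, c ≠ l → (e' c : ℕ) = if (e c : ℕ) ≤ e w then (e c : ℕ) else e c - 1

variable {e e' : A ≃ Fin (Fintype.card A)} {w l : A}

/-- The hypothesis guarantees that some letter follows `w`; this letter is the one moved. -/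
theorem movesToEnd_tailCycle [Nontrivial A] (hw : e w ≠ lastPos A) :
    MovesToEnd e (e.trans (tailCycle _ (e w)).symm) w
      ((e.trans (tailCycle _ (e w)).symm).symm (lastPos A)) := by
  have hlt : (e w : ℕ) < Fintype.card A - 1 := by
    have h1 := (e w).2
    have h2 : (e w : ℕ) ≠ Fintype.card A - 1 := fun h => hw (Fin.ext h)
    omega
  have hsrc : (e ((e.trans (tailCycle _ (e w)).symm).symm (lastPos A)) : ℕ) = e w + 1 := by
    simp only [Equiv.symm_trans_apply, Equiv.symm_symm, Equiv.apply_symm_apply]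
    simp only [tailCycle, lastPos, Equiv.coe_fn_mk]
    rw [if_neg (by omega)]
    simp
  refine ⟨fun h => ?_, hsrc, ?_, fun c hc => ?_⟩
  · rw [← h] at hsrc
    omega
  · simp [lastPos]
  · have hne : (e c : ℕ) ≠ e w + 1 := by
      intro h
      rw [← hsrc] at h
      exact hc (e.injective (Fin.ext h))
    simp only [Equiv.trans_apply, tailCycle, Equiv.coe_fn_symm_mk, if_neg hne]

theorem MovesToEnd.lt_iff (h : MovesToEnd e e' w l) {b c : A} (hb : b ≠ l) (hc : c ≠ l) :
    e' c < e' b ↔ e c < e b := by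
  have hbl : (e b : ℕ) ≠ e w + 1 := by
    rw [← h.source]; exact fun h => hb (e.injective (Fin.ext h))
  have hcl : (e c : ℕ) ≠ e w + 1 := by
    rw [← h.source]; exact fun h => hc (e.injective (Fin.ext h))
  rw [Fin.lt_def, Fin.lt_def, h.other b hb, h.other c hc]
  split_ifs <;> omega

theorem MovesToEnd.not_lt (h : MovesToEnd e e' w l) (b : A) : ¬ e' l < e' b := by
  have := (e' b).2
  rw [Fin.lt_def, h.target]
  omega

variable [DecidableEq A]

theorem rowSum_update (e : A ≃ Fin (Fintype.card A)) (f : A → ℝ) (w l b : A) :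
    rowSum e (Function.update f w (f w + f l)) b =
      rowSum e f b + if e w < e b then f l else 0 := by
  have h : ∀ c, Function.update f w (f w + f l) c = f c + if c = w then f l else 0 := by
    intro c
    by_cases hc : c = w
    · subst hc; simp
    · simp [hc]
  simp only [rowSum, h, Finset.sum_add_distrib]
  congr 1
  rw [Finset.sum_ite_eq']
  simp

theorem sum_update (f : A → ℝ) (w l : A) :
    ∑ a, Function.update f w (f w + f l) a = ∑ a, f a + f l := by
  have h : ∀ c, Function.update f w (f w + f l) c = f c + if c = w then f l else 0 := by
    intro c
    by_cases hc : c = w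
    · subst hc; simp
    · simp [hc]
  simp [h, Finset.sum_add_distrib]

/-- Since `w` immediately precedes `l`, both or neither lie before `b`; adding `f l` to the value at
`w` makes up for the departure of `l`. Lengths and suspension vectors obey the same update rule, so
this serves for both. -/
theorem MovesToEnd.rowSum_of_ne (h : MovesToEnd e e' w l) (f : A → ℝ) {b : A} (hb : b ≠ l) :
    rowSum e' (Function.update f w (f w + f l)) b = rowSum e f b := by
  have hwb : e l < e b ↔ e w < e b := by
    have : (e b : ℕ) ≠ e l := fun h => hb (e.injective (Fin.ext h))
    have := h.source
    rw [Fin.lt_def, Fin.lt_def]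
    omega
  have key : ∀ c, (if e c < e b then f c else 0) =
      (if e' c < e' b then f c else 0) + if c = l then (if e w < e b then f l else 0) else 0 := by
    intro c
    by_cases hc : c = l
    · subst hc
      simp [h.not_lt b, hwb]
    · simp [hc, h.lt_iff hb hc]
  rw [rowSum_update, rowSum_eq_sum_ite, rowSum_eq_sum_ite, Finset.sum_congr rfl fun c _ => key c,
    Finset.sum_add_distrib]
  simp [h.lt_iff hb h.ne]

theorem rowSum_of_last (e : A ≃ Fin (Fintype.card A)) (f : A → ℝ) {b : A}
    (hb : (e b : ℕ) = Fintype.card A - 1) : rowSum e f b = ∑ a, f a - f b := by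
  have key : ∀ c, (if e c < e b then f c else 0) = f c - if c = b then f b else 0 := by
    intro c
    by_cases hc : c = b
    · subst hc; simp
    · have : (e c : ℕ) ≠ e b := fun h => hc (e.injective (Fin.ext h))
      have h2 := (e c).2
      have : e c < e b := by rw [Fin.lt_def]; omega
      simp [hc, this]
  rw [rowSum_eq_sum_ite, Finset.sum_congr rfl fun c _ => key c]
  simp

theorem MovesToEnd.rowSum_moved (h : MovesToEnd e e' w l) (f : A → ℝ) :
    rowSum e' (Function.update f w (f w + f l)) l = ∑ a, f a := by
  rw [rowSum_of_last _ _ h.target, sum_update, Function.update_of_ne h.ne.symm]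
  ring

theorem MovesToEnd.rowSum_source (h : MovesToEnd e e' w l) (f : A → ℝ) :
    rowSum e f l = rowSum e f w + f w := by
  have key : ∀ c, (if e c < e l then f c else 0) =
      (if e c < e w then f c else 0) + if c = w then f w else 0 := by
    intro c
    have := h.source
    by_cases hc : c = w
    · subst hc
      have : e c < e l := by rw [Fin.lt_def]; omega
      simp [this]
    · have h1 : (e c : ℕ) ≠ e w := fun h => hc (e.injective (Fin.ext h))
      have : e c < e l ↔ e c < e w := by rw [Fin.lt_def, Fin.lt_def]; omega
      simp [hc, this]
  rw [rowSum_eq_sum_ite, rowSum_eq_sum_ite, Finset.sum_congr rfl fun c _ => key c,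
    Finset.sum_add_distrib]
  simp

theorem rowSum_update_of_last (e : A ≃ Fin (Fintype.card A)) (f : A → ℝ)
    (hw : (e w : ℕ) = Fintype.card A - 1) (b : A) :
    rowSum e (Function.update f w (f w + f l)) b = rowSum e f b := by
  have := (e b).2
  have : ¬ e w < e b := by rw [Fin.lt_def]; omega
  simp [rowSum_update, this]

/-- The total is the only new partial sum, so its sign alone decides whether the suspension
inequalities survive. -/
theorem MovesToEnd.exists_rowSum (h : MovesToEnd e e' w l) (f : A → ℝ) {k : ℕ} (hk : 1 ≤ k)
    (hkd : k < Fintype.card A) :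
    (∑ a with (e' a : ℕ) < k, Function.update f w (f w + f l) a = ∑ a, f a) ∨
    ∃ j, 1 ≤ j ∧ j < Fintype.card A ∧
      ∑ a with (e' a : ℕ) < k, Function.update f w (f w + f l) a = ∑ a with (e a : ℕ) < j, f a := by
  obtain ⟨b, hb⟩ := e'.surjective ⟨k, hkd⟩
  have hk' : (e' b : ℕ) = k := by rw [hb]
  have h1 : ∑ a with (e' a : ℕ) < k, Function.update f w (f w + f l) a =
      rowSum e' (Function.update f w (f w + f l)) b := by
    simp only [rowSum, Fin.lt_def, hk']
  rw [h1]
  by_cases hbl : b = l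
  · subst hbl
    exact Or.inl (h.rowSum_moved f)
  · refine Or.inr ⟨e b, ?_, (e b).2, h.rowSum_of_ne f hbl⟩
    have := h.other b hbl
    split_ifs at this <;> omega

theorem sum_update_of_last (e : A ≃ Fin (Fintype.card A)) (f : A → ℝ)
    (hw : (e w : ℕ) = Fintype.card A - 1) {k : ℕ} (hk : k < Fintype.card A) :
    ∑ a with (e a : ℕ) < k, Function.update f w (f w + f l) a = ∑ a with (e a : ℕ) < k, f a := by
  refine Finset.sum_congr rfl fun a ha => ?_
  rw [Finset.mem_filter] at ha
  rw [Function.update_of_ne]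
  rintro rfl
  omega

theorem om_mulVec (p : CombData A) (f : A → ℝ) (b : A) :
    (p.Om *ᵥ f) b = rowSum p.bot f b - rowSum p.top f b := by
  rw [rowSum_eq_sum_ite, rowSum_eq_sum_ite, ← Finset.sum_sub_distrib, Matrix.mulVec, dotProduct]
  refine Finset.sum_congr rfl fun c _ => ?_
  simp only [CombData.Om, Matrix.of_apply]
  by_cases hcb : c = b
  · subst hcb; simp
  have h1 : (p.top c : ℕ) ≠ p.top b := fun h => hcb (p.top.injective (Fin.ext h))
  have h2 : (p.bot c : ℕ) ≠ p.bot b := fun h => hcb (p.bot.injective (Fin.ext h))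
  simp only [Fin.lt_def]
  rcases lt_or_gt_of_ne h1 with h1 | h1 <;> rcases lt_or_gt_of_ne h2 with h2 | h2 <;>
    simp [h1, h2, h1.not_gt, h2.not_gt]

end Rows

/-! ### Suspension vectors and heights under the backward step -/

namespace SuspData

variable {A : Type*} [Fintype A]

theorem height_eq (s : SuspData A) (b : A) :
    s.height b = rowSum s.comb.top s.tau b - rowSum s.comb.bot s.tau b := by
  classical
  simp [height, om_mulVec]

variable [Nontrivial A]

/-- With a common last letter, the first `d - 1` letters of both rows would form the same set, whose
sum would be both positive and negative. -/
theorem IsSuspension.lastTop_ne_lastBot {s : SuspData A} (hs : s.IsSuspension) :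
    s.comb.lastTop ≠ s.comb.lastBot := by
  classical
  intro h
  have hc := Fintype.one_lt_card (α := A)
  obtain ⟨h1, h2⟩ := hs (Fintype.card A - 1) (by omega) (by omega)
  have : ∀ a, (s.comb.top a : ℕ) < Fintype.card A - 1 ↔
      (s.comb.bot a : ℕ) < Fintype.card A - 1 := by
    intro a
    have ht : (s.comb.top a : ℕ) = Fintype.card A - 1 ↔ a = s.comb.lastTop := by
      rw [CombData.lastTop, Equiv.eq_symm_apply, lastPos, Fin.ext_iff]
    have hb : (s.comb.bot a : ℕ) = Fintype.card A - 1 ↔ a = s.comb.lastBot := by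
      rw [CombData.lastBot, Equiv.eq_symm_apply, lastPos, Fin.ext_iff]
    rw [h, ← hb] at ht
    have := (s.comb.top a).2
    have := (s.comb.bot a).2
    omega
  simp only [this] at h1
  linarith

/-- The height is a top partial sum minus a bottom one. It could only vanish for a letter that is
first in both rows, which the case `k = 1` of the suspension condition excludes. -/
theorem IsSuspension.height_pos {s : SuspData A} (hs : s.IsSuspension) (b : A) :
    0 < s.height b := by
  have hc := Fintype.one_lt_card (α := A)
  have htop : (s.comb.top b : ℕ) = 0 ∧ rowSum s.comb.top s.tau b = 0 ∨
      0 < rowSum s.comb.top s.tau b := by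
    rcases Nat.eq_zero_or_pos (s.comb.top b : ℕ) with h | h
    · exact Or.inl ⟨h, by simp [rowSum, Fin.lt_def, h]⟩
    · exact Or.inr (hs _ h (s.comb.top b).2).1
  have hbot : (s.comb.bot b : ℕ) = 0 ∧ rowSum s.comb.bot s.tau b = 0 ∨
      rowSum s.comb.bot s.tau b < 0 := by
    rcases Nat.eq_zero_or_pos (s.comb.bot b : ℕ) with h | h
    · exact Or.inl ⟨h, by simp [rowSum, Fin.lt_def, h]⟩
    · exact Or.inr (hs _ h (s.comb.bot b).2).2
  rw [height_eq]
  rcases htop with ⟨h1, h1'⟩ | h1 <;> rcases hbot with ⟨h2, h2'⟩ | h2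
  · exfalso
    obtain ⟨h3, h4⟩ := hs 1 le_rfl hc
    have e1 : ∀ a, (s.comb.top a : ℕ) < 1 ↔ (s.comb.bot a : ℕ) < 1 := by
      intro a
      rw [Nat.lt_one_iff, Nat.lt_one_iff, ← h1, ← Fin.ext_iff, s.comb.top.apply_eq_iff_eq, h1,
        ← h2, ← Fin.ext_iff, s.comb.bot.apply_eq_iff_eq]
    simp only [e1] at h3
    linarith
  all_goals linarith

/-- The two cases of the backward step, in terms of the rows. -/
theorem step_cases {s : SuspData A} (hs : s.IsSuspension) :
    (s.IsTop ∧ s.prevComb.top = s.comb.top ∧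
      (s.comb.top s.winner : ℕ) = Fintype.card A - 1 ∧
      MovesToEnd s.comb.bot s.prevComb.bot s.winner s.loser) ∨
    (¬ s.IsTop ∧ s.prevComb.bot = s.comb.bot ∧
      (s.comb.bot s.winner : ℕ) = Fintype.card A - 1 ∧
      MovesToEnd s.comb.top s.prevComb.top s.winner s.loser) := by
  have hne := hs.lastTop_ne_lastBot
  by_cases h : s.IsTop
  · left
    have hp : s.prevComb = s.comb.RtInv := if_pos h
    have hw : s.winner = s.comb.lastTop := by
      simp only [winner, if_pos h, hp]; rfl
    have hl : s.loser = s.comb.RtInv.lastBot := by simp only [loser, if_pos h, hp]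
    refine ⟨h, by rw [hp]; rfl, ?_, ?_⟩
    · rw [hw, CombData.lastTop, Equiv.apply_symm_apply, lastPos]
    · rw [hw, hl, hp]
      refine movesToEnd_tailCycle fun h => hne ?_
      rw [CombData.lastBot, ← h, Equiv.symm_apply_apply]
  · right
    have hp : s.prevComb = s.comb.RbInv := if_neg h
    have hw : s.winner = s.comb.lastBot := by
      simp only [winner, if_neg h, hp]; rfl
    have hl : s.loser = s.comb.RbInv.lastTop := by simp only [loser, if_neg h, hp]
    refine ⟨h, by rw [hp]; rfl, ?_, ?_⟩
    · rw [hw, CombData.lastBot, Equiv.apply_symm_apply, lastPos]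
    · rw [hw, hl, hp]
      refine movesToEnd_tailCycle fun h => hne ?_
      rw [CombData.lastTop, ← h, Equiv.symm_apply_apply]

theorem IsSuspension.winner_ne_loser {s : SuspData A} (hs : s.IsSuspension) :
    s.winner ≠ s.loser := by
  rcases step_cases hs with ⟨-, -, -, h⟩ | ⟨-, -, -, h⟩ <;> exact h.ne

variable [DecidableEq A]

theorem IsSuspension.backStep {s : SuspData A} (hs : s.IsSuspension) (h0 : ∑ a, s.tau a ≠ 0) :
    s.backStep.IsSuspension := by
  intro k hk hkd
  rcases step_cases hs with ⟨ht, hrow, hlast, hmove⟩ | ⟨ht, hrow, hlast, hmove⟩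
  · refine ⟨?_, ?_⟩
    · simp only [SuspData.backStep, hrow]
      rw [sum_update_of_last _ _ hlast hkd]
      exact (hs k hk hkd).1
    · simp only [SuspData.backStep]
      rcases hmove.exists_rowSum s.tau hk hkd with h | ⟨j, hj, hjd, h⟩
      · exact h.trans_lt ht
      · exact h.trans_lt (hs j hj hjd).2
  · refine ⟨?_, ?_⟩
    · simp only [SuspData.backStep]
      rcases hmove.exists_rowSum s.tau hk hkd with h | ⟨j, hj, hjd, h⟩
      · exact (lt_of_le_of_ne (not_lt.1 ht) h0.symm).trans_eq h.symm
      · exact ((hs j hj hjd).1).trans_eq h.symm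
    · simp only [SuspData.backStep, hrow]
      rw [sum_update_of_last _ _ hlast hkd]
      exact (hs k hk hkd).2

theorem height_backStep_of_ne {s : SuspData A} (hs : s.IsSuspension) {b : A} (hb : b ≠ s.loser) :
    s.backStep.height b = s.height b := by
  rw [height_eq, height_eq]
  rcases step_cases hs with ⟨ht, hrow, hlast, hmove⟩ | ⟨ht, hrow, hlast, hmove⟩ <;>
    simp only [SuspData.backStep, hrow] <;>
    rw [rowSum_update_of_last _ _ hlast, hmove.rowSum_of_ne _ hb]

theorem height_loser {s : SuspData A} (hs : s.IsSuspension) :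
    s.height s.loser = s.backStep.height s.loser + s.backStep.height s.winner := by
  rw [height_backStep_of_ne hs hs.winner_ne_loser, height_eq, height_eq, height_eq]
  rcases step_cases hs with ⟨ht, hrow, hlast, hmove⟩ | ⟨ht, hrow, hlast, hmove⟩ <;>
    simp only [SuspData.backStep, hrow] <;>
    rw [rowSum_update_of_last _ _ hlast, hmove.rowSum_moved, hmove.rowSum_source,
      rowSum_of_last _ _ hlast] <;>
    ring

theorem IsSuspension.back {s : SuspData A} (hs : s.IsSuspension)
    (h0 : ∀ N, ∑ a, (s.back N).tau a ≠ 0) (N : ℕ) : (s.back N).IsSuspension := by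
  induction N with
  | zero => exact hs
  | succ N ih => exact ih.backStep (h0 N)

theorem back_add (s : SuspData A) (M N : ℕ) : s.back (M + N) = (s.back M).back N := by
  induction N with
  | zero => rfl
  | succ N ih => rw [← Nat.add_assoc, back, ih, back]

open Classical in
/-- In a path of the Rauzy diagram, the winner of an arrow takes part in the next one;
it loses if the type changes. -/
theorem winner_backStep (s : SuspData A) :
    s.backStep.winner = if (s.IsTop ↔ s.backStep.IsTop) then s.winner else s.loser := by
  have key : ∀ t : SuspData A, t.winner = if t.IsTop then t.comb.lastTop else t.comb.lastBot := by
    intro t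
    by_cases h : t.IsTop
    · simp only [winner, prevComb, if_pos h]; rfl
    · simp only [winner, prevComb, if_neg h]; rfl
  rw [key s.backStep]
  by_cases h : s.IsTop <;> by_cases h' : s.backStep.IsTop <;>
    simp [h, winner, loser, backStep]

end SuspData

end RauzyVeech

namespace RauzyVeech

/-! ### Itineraries -/

/-- The orbit of `x` under `T` visits successively the sets `J b`, for `b` in the list. -/
def Follows {A : Type*} (T : ℝ → ℝ) (J : A → Set ℝ) : List A → ℝ → Prop
  | [], _ => True
  | b :: w, x => x ∈ J b ∧ Follows T J w (T x)

theorem Follows.iterate_mem {A : Type*} {T : ℝ → ℝ} {J : A → Set ℝ} {w : List A} {x : ℝ}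
    (h : Follows T J w x) (j : ℕ) (hj : j < w.length) : T^[j] x ∈ J w[j] := by
  induction w generalizing x j with
  | nil => simp at hj
  | cons b w ih =>
    cases j with
    | zero => exact h.1
    | succ j => exact ih h.2 j (by simpa using hj)

section Exchange

variable {A : Type*} [Fintype A]

theorem leftEnd_eq (p : CombData A) (len : A → ℝ) (a : A) :
    leftEnd p len a = rowSum p.top len a := rfl

theorem rowSum_add_le {e : A ≃ Fin (Fintype.card A)} {len : A → ℝ} (hlen : ∀ a, 0 < len a)
    {a b : A} (h : e a < e b) : rowSum e len a + len a ≤ rowSum e len b := by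
  classical
  have : rowSum e len a + len a = ∑ c ∈ insert a (Finset.univ.filter fun c => e c < e a), len c := by
    rw [Finset.sum_insert (by simp), rowSum, add_comm]
  rw [this, rowSum]
  refine Finset.sum_le_sum_of_subset_of_nonneg ?_ fun c _ _ => (hlen c).le
  intro c hc
  simp only [Finset.mem_insert, Finset.mem_filter, Finset.mem_univ, true_and] at hc ⊢
  rcases hc with rfl | hc
  · exact h
  · exact hc.trans h

theorem eq_of_mem_exch {p : CombData A} {len : A → ℝ} (hlen : ∀ a, 0 < len a) {a b : A} {x : ℝ}
    (ha : x ∈ Ico (leftEnd p len a) (leftEnd p len a + len a))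
    (hb : x ∈ Ico (leftEnd p len b) (leftEnd p len b + len b)) : a = b := by
  by_contra hne
  have h : p.top a ≠ p.top b := fun h => hne (p.top.injective h)
  rw [leftEnd_eq] at ha hb
  rcases lt_or_gt_of_ne h with h | h
  · have := rowSum_add_le hlen h
    linarith [ha.2, hb.1]
  · have := rowSum_add_le hlen h
    linarith [hb.2, ha.1]

theorem iem_eq {p : CombData A} {len : A → ℝ} (hlen : ∀ a, 0 < len a) {b : A} {x : ℝ}
    (hx : x ∈ exchInt p len b) : iem p len x = x + (rowSum p.bot len b - rowSum p.top len b) := by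
  classical
  have hx' := Ioo_subset_Ico_self hx
  rw [iem, Finset.sum_eq_single b]
  · rw [if_pos hx', om_mulVec]
  · intro c _ hc
    rw [if_neg]
    exact fun h => hc (eq_of_mem_exch hlen h hx')
  · simp

end Exchange

variable {A : Type*} [Fintype A] [Nontrivial A] [DecidableEq A]

namespace SuspData

open Classical in
/-- The substitution describing how the towers of `s` are cut by the towers of `s.backStep`. -/
def sub (s : SuspData A) (b : A) : List A :=
  if b = s.loser then (if s.IsTop then [s.loser, s.winner] else [s.winner, s.loser]) else [b]

/-- The itinerary of the interval of the letter `a` for the interval exchange map at time `-N`. -/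
def word (s : SuspData A) : ℕ → A → List A
  | 0, a => [a]
  | N + 1, a => (s.word N a).flatMap (s.back N).sub

/-- The length vector of the backward step. -/
def stepLen (s : SuspData A) (len : A → ℝ) : A → ℝ :=
  Function.update len s.winner (len s.winner + len s.loser)

theorem stepLen_pos (s : SuspData A) {len : A → ℝ} (hlen : ∀ a, 0 < len a) (a : A) :
    0 < s.stepLen len a := by
  by_cases h : a = s.winner
  · subst h; simp [stepLen, hlen, add_pos]
  · simp [stepLen, h, hlen]

theorem backLen_pos (s : SuspData A) {len : A → ℝ} (hlen : ∀ a, 0 < len a) (N : ℕ) :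
    ∀ a, 0 < s.backLen len N a := by
  induction N with
  | zero => exact hlen
  | succ N ih => exact (s.back N).stepLen_pos ih

theorem le_stepLen (s : SuspData A) {len : A → ℝ} (hlen : ∀ a, 0 < len a) (a : A) :
    len a ≤ s.stepLen len a := by
  by_cases h : a = s.winner
  · subst h; simp [stepLen, (hlen _).le]
  · simp [stepLen, h]

theorem exchInt_step_of_ne {s : SuspData A} (hs : s.IsSuspension) {len : A → ℝ}
    (hlen : ∀ a, 0 < len a) {b : A} (hb : b ≠ s.loser) {x : ℝ} (hx : x ∈ exchInt s.comb len b) :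
    x ∈ exchInt s.prevComb (s.stepLen len) b ∧
      iem s.prevComb (s.stepLen len) x = iem s.comb len x := by
  have htop : rowSum s.prevComb.top (s.stepLen len) b = rowSum s.comb.top len b := by
    rcases step_cases hs with ⟨ht, hrow, hlast, hmove⟩ | ⟨ht, hrow, hlast, hmove⟩
    · rw [hrow, stepLen, rowSum_update_of_last _ _ hlast]
    · rw [stepLen, hmove.rowSum_of_ne _ hb]
  have hbot : rowSum s.prevComb.bot (s.stepLen len) b = rowSum s.comb.bot len b := by
    rcases step_cases hs with ⟨ht, hrow, hlast, hmove⟩ | ⟨ht, hrow, hlast, hmove⟩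
    · rw [stepLen, hmove.rowSum_of_ne _ hb]
    · rw [hrow, stepLen, rowSum_update_of_last _ _ hlast]
  have hmem : x ∈ exchInt s.prevComb (s.stepLen len) b := by
    rw [exchInt, leftEnd_eq, htop]
    rw [exchInt, leftEnd_eq] at hx
    exact ⟨hx.1, hx.2.trans_le (by linarith [s.le_stepLen hlen b])⟩
  refine ⟨hmem, ?_⟩
  rw [iem_eq (s.stepLen_pos hlen) hmem, iem_eq hlen hx, htop, hbot]

theorem exchInt_step_loser_top {s : SuspData A} (hs : s.IsSuspension) (ht : s.IsTop) {len : A → ℝ}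
    (hlen : ∀ a, 0 < len a) {x : ℝ} (hx : x ∈ exchInt s.comb len s.loser) :
    x ∈ exchInt s.prevComb (s.stepLen len) s.loser ∧
      iem s.prevComb (s.stepLen len) x ∈ exchInt s.prevComb (s.stepLen len) s.winner ∧
      iem s.prevComb (s.stepLen len) (iem s.prevComb (s.stepLen len) x) = iem s.comb len x := by
  rcases step_cases hs with ⟨-, hrow, hlast, hmove⟩ | ⟨h, -⟩
  swap
  · exact absurd ht h
  have hpos := s.stepLen_pos hlen
  have hl : s.stepLen len s.loser = len s.loser := Function.update_of_ne hmove.ne.symm _ _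
  have hw : s.stepLen len s.winner = len s.winner + len s.loser := Function.update_self _ _ _
  have htop : ∀ b, rowSum s.prevComb.top (s.stepLen len) b = rowSum s.comb.top len b := by
    intro b; rw [hrow, stepLen, rowSum_update_of_last _ _ hlast]
  have hmem : x ∈ exchInt s.prevComb (s.stepLen len) s.loser := by
    rw [exchInt, leftEnd_eq, htop, hl]; exact hx
  have hb1 : rowSum s.prevComb.bot (s.stepLen len) s.loser = ∑ a, len a := hmove.rowSum_moved len
  have hb2 : rowSum s.prevComb.bot (s.stepLen len) s.winner = rowSum s.comb.bot len s.winner :=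
    hmove.rowSum_of_ne len hmove.ne
  have hb3 := hmove.rowSum_source len
  have htw := rowSum_of_last s.comb.top len hlast
  have e1 := iem_eq hpos hmem
  rw [htop, hb1] at e1
  have hmem2 : iem s.prevComb (s.stepLen len) x ∈
      exchInt s.prevComb (s.stepLen len) s.winner := by
    rw [e1, exchInt, leftEnd_eq, htop, hw, htw]
    rw [exchInt, leftEnd_eq] at hx
    have := hlen s.winner
    constructor <;> linarith [hx.1, hx.2]
  refine ⟨hmem, hmem2, ?_⟩
  rw [iem_eq hpos hmem2, e1, iem_eq hlen hx, htop, hb2, htw, hb3]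
  ring

theorem exchInt_step_loser_bot {s : SuspData A} (hs : s.IsSuspension) (ht : ¬ s.IsTop)
    {len : A → ℝ} (hlen : ∀ a, 0 < len a) {x : ℝ} (hx : x ∈ exchInt s.comb len s.loser) :
    x ∈ exchInt s.prevComb (s.stepLen len) s.winner ∧
      iem s.prevComb (s.stepLen len) x ∈ exchInt s.prevComb (s.stepLen len) s.loser ∧
      iem s.prevComb (s.stepLen len) (iem s.prevComb (s.stepLen len) x) = iem s.comb len x := by
  rcases step_cases hs with ⟨h, -⟩ | ⟨-, hrow, hlast, hmove⟩
  · exact absurd h ht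
  have hpos := s.stepLen_pos hlen
  have hl : s.stepLen len s.loser = len s.loser := Function.update_of_ne hmove.ne.symm _ _
  have hw : s.stepLen len s.winner = len s.winner + len s.loser := Function.update_self _ _ _
  have hbot : ∀ b, rowSum s.prevComb.bot (s.stepLen len) b = rowSum s.comb.bot len b := by
    intro b; rw [hrow, stepLen, rowSum_update_of_last _ _ hlast]
  have ht1 : rowSum s.prevComb.top (s.stepLen len) s.loser = ∑ a, len a := hmove.rowSum_moved len
  have ht2 : rowSum s.prevComb.top (s.stepLen len) s.winner = rowSum s.comb.top len s.winner :=
    hmove.rowSum_of_ne len hmove.ne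
  have ht3 := hmove.rowSum_source len
  have hbw := rowSum_of_last s.comb.bot len hlast
  have hx' := hx
  rw [exchInt, leftEnd_eq, ht3] at hx'
  have hmem : x ∈ exchInt s.prevComb (s.stepLen len) s.winner := by
    rw [exchInt, leftEnd_eq, ht2, hw]
    have := hlen s.winner
    constructor <;> linarith [hx'.1, hx'.2]
  have e1 := iem_eq hpos hmem
  rw [hbot, ht2, hbw] at e1
  have hmem2 : iem s.prevComb (s.stepLen len) x ∈
      exchInt s.prevComb (s.stepLen len) s.loser := by
    rw [e1, exchInt, leftEnd_eq, ht1, hl]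
    constructor <;> linarith [hx'.1, hx'.2]
  refine ⟨hmem, hmem2, ?_⟩
  rw [iem_eq hpos hmem2, e1, iem_eq hlen hx, hbot, ht1, ht3]
  ring

/-- The old exchange is induced by the new one: a point in the interval of the loser needs two steps
of the new map, any other point one step. The order of the two letters depends on the type. -/
theorem follows_step {s : SuspData A} (hs : s.IsSuspension) {len : A → ℝ} (hlen : ∀ a, 0 < len a)
    (w : List A) (x : ℝ) (h : Follows (iem s.comb len) (exchInt s.comb len) w x) :
    Follows (iem s.prevComb (s.stepLen len)) (exchInt s.prevComb (s.stepLen len))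
      (w.flatMap s.sub) x := by
  induction w generalizing x with
  | nil => trivial
  | cons b w ih =>
    obtain ⟨hx, hr⟩ := h
    rw [List.flatMap_cons, sub]
    split_ifs with hb ht
    · subst hb
      obtain ⟨h1, h2, h3⟩ := exchInt_step_loser_top hs ht hlen hx
      exact ⟨h1, h2, ih _ (h3 ▸ hr)⟩
    · subst hb
      obtain ⟨h1, h2, h3⟩ := exchInt_step_loser_bot hs ht hlen hx
      exact ⟨h1, h2, ih _ (h3 ▸ hr)⟩
    · obtain ⟨h1, h2⟩ := exchInt_step_of_ne hs hlen hb hx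
      exact ⟨h1, ih _ (h2 ▸ hr)⟩

theorem follows_word {s : SuspData A} (hs : ∀ N, (s.back N).IsSuspension) {len : A → ℝ}
    (hlen : ∀ a, 0 < len a) {a : A} {x : ℝ} (hx : x ∈ exchInt s.comb len a) (N : ℕ) :
    Follows (iem (s.back N).comb (s.backLen len N)) (exchInt (s.back N).comb (s.backLen len N))
      (s.word N a) x := by
  induction N with
  | zero => exact ⟨hx, trivial⟩
  | succ N ih => exact follows_step (hs N) (s.backLen_pos hlen N) _ _ ih

theorem visit_eq {s : SuspData A} (hs : ∀ N, (s.back N).IsSuspension) {len : A → ℝ}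
    (hlen : ∀ a, 0 < len a) (N : ℕ) (a : A) (j : ℕ) (hj : j < (s.word N a).length) :
    s.visit len N a j = (s.word N a)[j] := by
  have hmaps : MapsTo ((iem (s.back N).comb (s.backLen len N))^[j])
      (exchInt s.comb len a) (exchInt (s.back N).comb (s.backLen len N) (s.word N a)[j]) :=
    fun x hx => (follows_word hs hlen hx N).iterate_mem j hj
  have hspec := Classical.epsilon_spec (p := fun b : A =>
    MapsTo ((iem (s.back N).comb (s.backLen len N))^[j])
      (exchInt s.comb len a) (exchInt (s.back N).comb (s.backLen len N) b)) ⟨_, hmaps⟩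
  -- The midpoint shows that the interval is nonempty; as the exchanged intervals are disjoint, the
  -- letter chosen by `epsilon` is forced.
  have hx : leftEnd s.comb len a + len a / 2 ∈ exchInt s.comb len a := by
    constructor <;> linarith [hlen a]
  exact eq_of_mem_exch (s.backLen_pos hlen N) (Ioo_subset_Ico_self (hspec hx))
    (Ioo_subset_Ico_self (hmaps hx))

theorem word_add (s : SuspData A) (M N : ℕ) (a : A) :
    s.word (M + N) a = (s.word M a).flatMap ((s.back M).word N) := by
  induction N with
  | zero => simp [word]
  | succ N ih =>
    rw [← Nat.add_assoc, word, ih, List.flatMap_assoc]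
    simp only [word, back_add]

/-! ### The matrices -/

theorem B_self (s : SuspData A) (N : ℕ) : s.B N N = 1 := by simp [B]

theorem B_succ (s : SuspData A) {M N : ℕ} (h : N ≤ M) :
    s.B (M + 1) N = s.B M N * (s.back M).arrowMatrix := by
  rw [B, B, Nat.succ_sub h, List.range'_concat, List.map_append, List.prod_append]
  simp [Nat.add_sub_cancel' h]

theorem B_mul (s : SuspData A) {K M N : ℕ} (h : N ≤ M) (h' : M ≤ K) :
    s.B K N = s.B M N * s.B K M := by
  induction K, h' using Nat.le_induction with
  | base => simp [B_self]
  | succ K h' ih => rw [B_succ s (h.trans h'), ih, B_succ s h', Matrix.mul_assoc]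

theorem B_back (s : SuspData A) (M N : ℕ) : (s.back M).B N 0 = s.B (M + N) M := by
  induction N with
  | zero => simp [B_self]
  | succ N ih => rw [B_succ _ (Nat.zero_le _), ih, ← Nat.add_assoc, B_succ _ (Nat.le_add_right _ _),
      back_add]

theorem mul_arrowMatrix (s : SuspData A) (X : Matrix A A ℕ) (a b : A) :
    (X * s.arrowMatrix) a b = X a b + if b = s.winner then X a s.loser else 0 := by
  rw [arrowMatrix, Matrix.mul_add, Matrix.mul_one, Matrix.add_apply]
  congr 1
  split_ifs with h
  · subst h; simp
  · rw [Matrix.mul_single_apply_of_ne _ _ _ _ _ h]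

end SuspData

theorem count_flatMap {A : Type*} [Fintype A] [DecidableEq A] (w : List A) (f : A → List A)
    (c : A) :
    (w.flatMap f).count c = ∑ b, w.count b * (f b).count c := by
  induction w with
  | nil => simp
  | cons b w ih =>
    rw [List.flatMap_cons, List.count_append, ih]
    simp only [List.count_cons, add_mul, Finset.sum_add_distrib, beq_iff_eq, ite_mul, one_mul,
      zero_mul, Finset.sum_ite_eq, Finset.mem_univ, if_true]
    ring

theorem sum_count {A : Type*} [Fintype A] [DecidableEq A] (w : List A) : ∑ b, w.count b = w.length := by
  induction w with
  | nil => simp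
  | cons b w ih => simp [List.count_cons, Finset.sum_add_distrib, ih]

namespace SuspData

theorem count_sub (s : SuspData A) (hne : s.winner ≠ s.loser) (b c : A) :
    (s.sub b).count c = s.arrowMatrix b c := by
  have h := s.mul_arrowMatrix 1 b c
  rw [Matrix.one_mul] at h
  rw [h, sub, Matrix.one_apply, Matrix.one_apply]
  by_cases hb : b = s.loser
  · subst hb
    by_cases hc : c = s.winner
    · subst hc
      by_cases ht : s.IsTop <;> simp [ht, hne, hne.symm]
    · have hc' : s.winner ≠ c := Ne.symm hc
      by_cases ht : s.IsTop <;> simp [ht, List.count_cons, hc, hc']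
  · simp [hb, List.count_cons]

/-- The arrow matrix is the incidence matrix of the substitution `sub`, so the product of arrow
matrices is that of the iterated substitution. -/
theorem count_word {s : SuspData A} (hs : ∀ N, (s.back N).IsSuspension) (N : ℕ) (a c : A) :
    (s.word N a).count c = s.B N 0 a c := by
  induction N generalizing c with
  | zero => simp [word, B_self, Matrix.one_apply, List.count_cons]
  | succ N ih =>
    rw [word, count_flatMap, B_succ _ (Nat.zero_le _), Matrix.mul_apply]
    exact Finset.sum_congr rfl fun b _ => by rw [ih, count_sub _ (hs N).winner_ne_loser]

theorem length_word {s : SuspData A} (hs : ∀ N, (s.back N).IsSuspension) (N : ℕ) (a : A) :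
    (s.word N a).length = s.retTime N a := by
  rw [← sum_count, retTime]
  exact Finset.sum_congr rfl fun b _ => count_word hs N a b

end SuspData

/-! ### Piecewise affine graphs -/

/-- The piecewise affine function whose successive pieces are given by a list of letters. -/
def listGraph (q χ : A → ℝ) : List A → ℝ → ℝ
  | [], _ => 0
  | b :: w, x => χ b * max 0 (min 1 (x / q b)) + listGraph q χ w (x - q b)

theorem pwAffine_succ (K : ℕ) (len inc : ℕ → ℝ) (x : ℝ) :
    pwAffine (K + 1) len inc x = inc 0 * max 0 (min 1 (x / len 0)) +
      pwAffine K (fun j => len (j + 1)) (fun j => inc (j + 1)) (x - len 0) := by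
  rw [pwAffine, Finset.sum_range_succ', add_comm, pwAffine]
  congr 1
  · simp
  · refine Finset.sum_congr rfl fun j _ => ?_
    rw [Finset.sum_range_succ', sub_sub, add_comm (len 0)]

theorem pwAffine_eq_listGraph {A : Type*} (q χ : A → ℝ) (w : List A)
    (f : ℕ → A) (hf : ∀ j (h : j < w.length), f j = w[j]) (x : ℝ) :
    pwAffine w.length (fun j => q (f j)) (fun j => χ (f j)) x = listGraph q χ w x := by
  induction w generalizing f x with
  | nil => simp [pwAffine, listGraph]
  | cons b w ih =>
    have h0 : f 0 = b := hf 0 (by simp)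
    rw [List.length_cons, pwAffine_succ, h0, listGraph,
      ih (fun j => f (j + 1)) fun j h => hf (j + 1) (by simpa using h)]

/-- The right-hand side does not involve `len`: this is where uniformity in the length vector comes
from. -/
theorem SuspData.sumGraph_eq {s : SuspData A} (hs : ∀ N, (s.back N).IsSuspension) {len : A → ℝ}
    (hlen : ∀ a, 0 < len a) (χ : A → ℝ) (N : ℕ) (a : A) (x : ℝ) :
    s.sumGraph len χ N a x = listGraph (s.back N).height (s.pull χ N) (s.word N a) x := by
  rw [sumGraph, ← length_word hs]
  exact pwAffine_eq_listGraph _ _ _ _ (fun j h => visit_eq hs hlen N a j h) x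

end RauzyVeech

namespace RauzyVeech

/-! ### Growth of the matrices -/

section MatNorm

variable {A : Type*} [Fintype A]

theorem matNorm_eq (X : Matrix A A ℕ) : matNorm X = ∑ b, ((∑ a, X a b : ℕ) : ℝ) := by
  rw [matNorm, ← Nat.cast_sum]
  exact congrArg Nat.cast Finset.sum_comm

theorem matNorm_nonneg (X : Matrix A A ℕ) : 0 ≤ matNorm X := Nat.cast_nonneg _

theorem le_matNorm (X : Matrix A A ℕ) (a b : A) : (X a b : ℝ) ≤ matNorm X := by
  rw [matNorm]
  refine Nat.cast_le.2 ?_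
  exact (Finset.single_le_sum (f := fun b => X a b) (fun _ _ => Nat.zero_le _)
    (Finset.mem_univ b)).trans (Finset.single_le_sum (f := fun a => ∑ b, X a b)
      (fun _ _ => Nat.zero_le _) (Finset.mem_univ a))

theorem matNorm_mul_le (X Y : Matrix A A ℕ) : matNorm (X * Y) ≤ matNorm X * matNorm Y := by
  rw [matNorm, matNorm, matNorm, ← Nat.cast_mul]
  refine Nat.cast_le.2 ?_
  calc ∑ a, ∑ b, (X * Y) a b = ∑ a, ∑ c, X a c * ∑ b, Y c b := by
        refine Finset.sum_congr rfl fun a _ => ?_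
        simp only [Matrix.mul_apply, Finset.mul_sum]
        rw [Finset.sum_comm]
    _ ≤ ∑ a, ∑ c, X a c * ∑ c, ∑ b, Y c b := by
        refine Finset.sum_le_sum fun a _ => Finset.sum_le_sum fun c _ =>
          Nat.mul_le_mul_left _ ?_
        exact Finset.single_le_sum (f := fun c => ∑ b, Y c b) (fun _ _ => Nat.zero_le _)
          (Finset.mem_univ c)
    _ = (∑ a, ∑ b, X a b) * ∑ a, ∑ b, Y a b := by
        simp only [Finset.sum_mul]

end MatNorm

variable {A : Type*} [Fintype A] [Nontrivial A] [DecidableEq A]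

namespace SuspData

/-- The sum of the column `b` of `B(-N, 0)`. -/
def colSum (s : SuspData A) (N : ℕ) (b : A) : ℕ := ∑ a, s.B N 0 a b

theorem colSum_zero (s : SuspData A) (b : A) : s.colSum 0 b = 1 := by
  simp [colSum, B_self, Matrix.one_apply]

theorem colSum_succ (s : SuspData A) (N : ℕ) (b : A) :
    s.colSum (N + 1) b =
      s.colSum N b + if b = (s.back N).winner then s.colSum N (s.back N).loser else 0 := by
  simp only [colSum, B_succ s (Nat.zero_le N), mul_arrowMatrix, Finset.sum_add_distrib]
  split_ifs <;> simp

theorem colSum_mono (s : SuspData A) (b : A) : Monotone fun N => s.colSum N b :=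
  monotone_nat_of_le_succ fun N => by rw [colSum_succ]; exact Nat.le_add_right _ _

theorem one_le_colSum (s : SuspData A) (N : ℕ) (b : A) : 1 ≤ s.colSum N b :=
  (s.colSum_zero b).symm.le.trans (s.colSum_mono b (Nat.zero_le N))

theorem colSum_mul (s : SuspData A) {M N : ℕ} (h : N ≤ M) (b : A) :
    s.colSum M b = ∑ a, s.colSum N a * s.B M N a b := by
  simp only [colSum, B_mul s (Nat.zero_le N) h, Matrix.mul_apply, Finset.sum_mul]
  rw [Finset.sum_comm]

theorem norm_B_eq (s : SuspData A) (N : ℕ) :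
    matNorm (s.B N 0) = ∑ b, (s.colSum N b : ℝ) := matNorm_eq _

theorem norm_B_succ (s : SuspData A) (N : ℕ) :
    matNorm (s.B (N + 1) 0) = matNorm (s.B N 0) + s.colSum N (s.back N).loser := by
  rw [norm_B_eq, norm_B_eq]
  simp only [colSum_succ, Nat.cast_add, Finset.sum_add_distrib]
  simp

theorem norm_B_zero (s : SuspData A) : matNorm (s.B 0 0) = Fintype.card A := by
  rw [norm_B_eq]; simp [colSum_zero]

theorem colSum_le_norm (s : SuspData A) (N : ℕ) (b : A) :
    (s.colSum N b : ℝ) ≤ matNorm (s.B N 0) := by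
  rw [norm_B_eq]
  exact Finset.single_le_sum (f := fun b => (s.colSum N b : ℝ)) (fun _ _ => Nat.cast_nonneg _)
    (Finset.mem_univ b)

theorem norm_B_mono (s : SuspData A) : Monotone fun N => matNorm (s.B N 0) :=
  monotone_nat_of_le_succ fun N => by rw [norm_B_succ]; simp

theorem norm_B_succ_le (s : SuspData A) (N : ℕ) :
    matNorm (s.B (N + 1) 0) ≤ 2 * matNorm (s.B N 0) := by
  rw [norm_B_succ]; linarith [s.colSum_le_norm N (s.back N).loser]

theorem natCast_lt_norm_B (s : SuspData A) (N : ℕ) : (N : ℝ) + 1 ≤ matNorm (s.B N 0) := by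
  induction N with
  | zero =>
    rw [norm_B_zero]
    exact_mod_cast (Nat.succ_le_of_lt Fintype.card_pos : 0 + 1 ≤ Fintype.card A)
  | succ N ih =>
    rw [norm_B_succ]
    have : (1 : ℝ) ≤ s.colSum N (s.back N).loser := by exact_mod_cast s.one_le_colSum N _
    push_cast; linarith

theorem one_le_norm_B (s : SuspData A) (N : ℕ) : 1 ≤ matNorm (s.B N 0) :=
  le_trans (by simp) (s.natCast_lt_norm_B N)

theorem norm_B_pos (s : SuspData A) (N : ℕ) : 0 < matNorm (s.B N 0) :=
  zero_lt_one.trans_le (s.one_le_norm_B N)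

theorem tendsto_norm_B (s : SuspData A) : Tendsto (fun N => matNorm (s.B N 0)) atTop atTop :=
  tendsto_atTop_mono (fun N => (by linarith [s.natCast_lt_norm_B N] : (N : ℝ) ≤ _))
    tendsto_natCast_atTop_atTop

/-! ### Zorich time -/

theorem prod_colSum_succ (s : SuspData A) (N : ℕ) :
    (∏ b, s.colSum (N + 1) b) * s.colSum N (s.back N).winner =
      (∏ b, s.colSum N b) * (s.colSum N (s.back N).winner + s.colSum N (s.back N).loser) := by
  set w := (s.back N).winner
  rw [← Finset.mul_prod_erase Finset.univ _ (Finset.mem_univ w),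
    ← Finset.mul_prod_erase Finset.univ (fun b => s.colSum N b) (Finset.mem_univ w)]
  have : ∏ b ∈ Finset.univ.erase w, s.colSum (N + 1) b = ∏ b ∈ Finset.univ.erase w, s.colSum N b :=
    Finset.prod_congr rfl fun b hb => by
      rw [colSum_succ, if_neg (Finset.ne_of_mem_erase hb), add_zero]
  rw [this, colSum_succ, if_pos rfl]
  ring

/-- Potential argument. The next winner is the current winner or, when the type changes, the current
loser; `prod_colSum_succ` gives the growth of the product of the column sums. The factor `4` paid
for a change of type is absorbed by `4 * c * l ≤ (c + l) ^ 2`. -/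
theorem four_pow_zorichTime_le {s : SuspData A} (hs : ∀ N, (s.back N).IsSuspension) (N : ℕ) :
    4 ^ s.zorichTime (N + 1) * s.colSum N (s.back N).winner ≤
      4 * (∏ b, s.colSum N b) ^ 2 := by
  induction N with
  | zero => simp [zorichTime, colSum_zero]
  | succ N ih =>
    have hP := s.prod_colSum_succ N
    have hw := winner_backStep (s.back N)
    set c := s.colSum N (s.back N).winner
    set l := s.colSum N (s.back N).loser
    set P := ∏ b, s.colSum N b
    set P' := ∏ b, s.colSum (N + 1) b
    have hc : 0 < c := s.one_le_colSum _ _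
    have key : (4 ^ s.zorichTime (N + 2) * s.colSum (N + 1) (s.back (N + 1)).winner) * c ^ 2 ≤
        (4 * P' ^ 2) * c ^ 2 := by
      have e : (4 * P' ^ 2) * c ^ 2 = 4 * P ^ 2 * (c + l) ^ 2 := by
        rw [mul_assoc, ← mul_pow, hP]; ring
      rw [e]
      have hw' : (s.back (N + 1)).winner = _ := hw
      rw [hw', zorichTime]
      by_cases h : (s.back N).IsTop ↔ (s.back (N + 1)).IsTop
      · rw [if_pos h, if_pos (show _ ↔ (s.back N).backStep.IsTop from h), colSum_succ, if_pos rfl]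
        calc 4 ^ (s.zorichTime (N + 1) + 0) * (c + l) * c ^ 2
            = (4 ^ s.zorichTime (N + 1) * c) * ((c + l) * c) := by rw [add_zero]; ring
          _ ≤ (4 * P ^ 2) * ((c + l) * (c + l)) := by gcongr; omega
          _ = _ := by ring
      · rw [if_neg h, if_neg (show ¬ (_ ↔ (s.back N).backStep.IsTop) from h), colSum_succ,
          if_neg (hs N).winner_ne_loser.symm]
        calc 4 ^ (s.zorichTime (N + 1) + 1) * (l + 0) * c ^ 2
            = (4 ^ s.zorichTime (N + 1) * c) * (4 * (c * l)) := by rw [pow_succ]; ring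
          _ ≤ (4 * P ^ 2) * ((c + l) ^ 2) := by
            gcongr
            zify
            nlinarith [sq_nonneg ((c : ℤ) - l)]
    exact Nat.le_of_mul_le_mul_right key (by positivity)

theorem zorichTime_le_succ (s : SuspData A) (N : ℕ) : s.zorichTime N ≤ s.zorichTime (N + 1) := by
  cases N with
  | zero => simp [zorichTime]
  | succ N => rw [zorichTime]; exact Nat.le_add_right _ _

theorem exp_zorichTime_le {s : SuspData A} (hs : ∀ N, (s.back N).IsSuspension) (N : ℕ) :
    Real.exp (s.zorichTime N) ≤ 4 * matNorm (s.B N 0) ^ (2 * Fintype.card A : ℝ) := by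
  have h1 := four_pow_zorichTime_le hs N
  have h2 : 4 ^ s.zorichTime N ≤ 4 * (∏ b, s.colSum N b) ^ 2 :=
    ((Nat.pow_le_pow_right (by norm_num) (s.zorichTime_le_succ N)).trans
      (Nat.le_mul_of_pos_right _ (s.one_le_colSum _ _))).trans h1
  have h3 : ∏ b, (s.colSum N b : ℝ) ≤ matNorm (s.B N 0) ^ Fintype.card A := by
    refine (Finset.prod_le_prod (fun _ _ => Nat.cast_nonneg _)
      fun b _ => s.colSum_le_norm N b).trans ?_
    rw [Finset.prod_const, Finset.card_univ]
  have h4 : ((4 : ℝ) ^ s.zorichTime N) ≤ 4 * (∏ b, (s.colSum N b : ℝ)) ^ 2 := by exact_mod_cast h2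
  calc Real.exp (s.zorichTime N) = Real.exp 1 ^ s.zorichTime N := by rw [← Real.exp_nat_mul, mul_one]
    _ ≤ 4 ^ s.zorichTime N := by
      gcongr
      exact (Real.exp_one_lt_d9.trans (by norm_num)).le
    _ ≤ 4 * (matNorm (s.B N 0) ^ Fintype.card A) ^ 2 := h4.trans (by gcongr)
    _ = _ := by
      rw [← pow_mul, ← Real.rpow_natCast]
      push_cast
      rw [mul_comm (2 : ℝ)]

/-! ### Vectors in the past -/

/-- The matrix `B(-N, 0)` with real entries. -/
def realB (s : SuspData A) (N : ℕ) : Matrix A A ℝ := (s.B N 0).map (Nat.cast : ℕ → ℝ)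

theorem realB_zero (s : SuspData A) : s.realB 0 = 1 := by
  simp [realB, B_self, Matrix.map_one]

theorem realB_succ (s : SuspData A) (N : ℕ) :
    s.realB (N + 1) =
      s.realB N * Matrix.transvection (s.back N).loser (s.back N).winner (1 : ℝ) := by
  have h : (s.back N).arrowMatrix.map (Nat.cast : ℕ → ℝ) =
      Matrix.transvection (s.back N).loser (s.back N).winner (1 : ℝ) := by
    rw [arrowMatrix, Matrix.transvection, Matrix.map_add _ Nat.cast_add,
      Matrix.map_one _ Nat.cast_zero Nat.cast_one]
    congr 1
    exact (Matrix.map_single _ _ _ (Nat.castRingHom ℝ)).trans (by simp)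
  rw [realB, B_succ _ (Nat.zero_le N), Matrix.map_mul_natCast, h, realB]

theorem det_realB {s : SuspData A} (hs : ∀ N, (s.back N).IsSuspension) (N : ℕ) :
    (s.realB N).det = 1 := by
  induction N with
  | zero => rw [realB_zero, Matrix.det_one]
  | succ N ih =>
    rw [realB_succ, Matrix.det_mul, ih,
      Matrix.det_transvection_of_ne _ _ (hs N).winner_ne_loser.symm, one_mul]

theorem transvection_mulVec {A : Type*} [Fintype A] [DecidableEq A] (l w : A)
    (v : A → ℝ) (b : A) :
    (Matrix.transvection l w (1 : ℝ) *ᵥ v) b = v b + if b = l then v w else 0 := by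
  rw [Matrix.transvection, Matrix.add_mulVec, Matrix.one_mulVec, Pi.add_apply]
  congr 1
  rw [Matrix.single_mulVec]
  simp [Function.update_apply]

theorem pull_eq {s : SuspData A} (hs : ∀ N, (s.back N).IsSuspension) (χ : A → ℝ) (N : ℕ) (b : A) :
    s.pull χ N b = s.pull χ (N + 1) b +
      if b = (s.back N).loser then s.pull χ (N + 1) (s.back N).winner else 0 := by
  rw [← transvection_mulVec]
  refine congrFun ?_ b
  change (s.realB N)⁻¹ *ᵥ χ = _ *ᵥ ((s.realB (N + 1))⁻¹ *ᵥ χ)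
  have hu : IsUnit (Matrix.transvection (s.back N).loser (s.back N).winner (1 : ℝ)).det := by
    rw [Matrix.det_transvection_of_ne _ _ (hs N).winner_ne_loser.symm]; exact isUnit_one
  rw [realB_succ, Matrix.mul_inv_rev, Matrix.mulVec_mulVec, ← Matrix.mul_assoc,
    Matrix.mul_nonsing_inv _ hu, Matrix.one_mul]

theorem height_eq_mulVec {s : SuspData A} (hs : ∀ N, (s.back N).IsSuspension) (N : ℕ) :
    s.height = s.realB N *ᵥ (s.back N).height := by
  induction N with
  | zero => rw [realB_zero, Matrix.one_mulVec]; rfl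
  | succ N ih =>
    rw [realB_succ, ← Matrix.mulVec_mulVec, ih]
    congr 1
    ext b
    rw [transvection_mulVec, back]
    split_ifs with h
    · subst h; exact height_loser (hs N)
    · rw [add_zero, height_backStep_of_ne (hs N) h]

/-- Zorich time is at most `2 * d * log x_N` up to an additive constant, so the rate `ε / (2 * d)`
in Zorich time becomes the exponent `ε`. -/
theorem exists_norm_pull_le {s : SuspData A} (hs : ∀ N, (s.back N).IsSuspension) {χ : A → ℝ}
    (hχ : s.IsCentral χ) {ε : ℝ} (hε : 0 < ε) :
    ∃ C : ℝ, 0 < C ∧ ∀ N, ‖s.pull χ N‖ ≤ C * matNorm (s.B N 0) ^ ε := by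
  have hd : (0 : ℝ) < 2 * Fintype.card A := by
    have : 0 < Fintype.card A := Fintype.card_pos
    positivity
  set ε' := ε / (2 * Fintype.card A) with hε'
  have hpos : 0 < ε' := by positivity
  obtain ⟨C, hC⟩ := hχ ε' hpos
  refine ⟨(|C| + 1) * 4 ^ ε', by positivity, fun N => (hC N).trans ?_⟩
  have hx := s.norm_B_pos N
  have h1 : Real.exp (ε' * s.zorichTime N) ≤ 4 ^ ε' * matNorm (s.B N 0) ^ ε := by
    calc Real.exp (ε' * s.zorichTime N) = Real.exp (s.zorichTime N) ^ ε' := by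
          rw [← Real.exp_mul, mul_comm]
      _ ≤ (4 * matNorm (s.B N 0) ^ (2 * Fintype.card A : ℝ)) ^ ε' := by
          gcongr
          exact exp_zorichTime_le hs N
      _ = _ := by
          rw [Real.mul_rpow (by norm_num) (by positivity), ← Real.rpow_mul hx.le, hε',
            mul_div_cancel₀ _ hd.ne']
  calc C * Real.exp (ε' * s.zorichTime N)
      ≤ (|C| + 1) * (4 ^ ε' * matNorm (s.B N 0) ^ ε) := by
        gcongr
        linarith [le_abs_self C]
    _ = _ := by ring

end SuspData

end RauzyVeech

namespace RauzyVeech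

/-! ### Positivity and balance of the matrices -/

variable {A : Type*} [Fintype A] [Nontrivial A] [DecidableEq A]

namespace SuspData

/-- The letters of the positive entries in the row `a` of `B(-M, -N)`. -/
def support (s : SuspData A) (N : ℕ) (a : A) (M : ℕ) : Finset A :=
  Finset.univ.filter fun b => 0 < s.B M N a b

theorem mem_support {s : SuspData A} {N M : ℕ} {a b : A} :
    b ∈ s.support N a M ↔ 0 < s.B M N a b := by simp [support]

theorem support_self (s : SuspData A) (N : ℕ) (a : A) : s.support N a N = {a} := by
  ext b
  rw [mem_support, B_self, Matrix.one_apply, Finset.mem_singleton]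
  split_ifs with h <;> simp [h, eq_comm]

theorem support_succ (s : SuspData A) {N M : ℕ} (h : N ≤ M) (a : A) :
    s.support N a M ⊆ s.support N a (M + 1) := by
  intro b
  rw [mem_support, mem_support, B_succ s h, mul_arrowMatrix]
  exact fun h => Nat.add_pos_left h _

theorem support_mono (s : SuspData A) {N M M' : ℕ} (h : N ≤ M) (h' : M ≤ M') (a : A) :
    s.support N a M ⊆ s.support N a M' := by
  induction M', h' using Nat.le_induction with
  | base => exact subset_rfl
  | succ K hK ih => exact ih.trans (s.support_succ (h.trans hK) a)

theorem winner_mem_support {s : SuspData A} {N M : ℕ} (h : N ≤ M) {a : A}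
    (hl : (s.back M).loser ∈ s.support N a M) : (s.back M).winner ∈ s.support N a (M + 1) := by
  rw [mem_support] at *
  rw [B_succ s h, mul_arrowMatrix, if_pos rfl]
  exact Nat.add_pos_right _ hl

/-- If the support stayed constant, take a letter outside it that wins in the first complete path.
From then on every winner is outside: a new winner is the preceding loser, and a loser in the
support would bring its winner in. But `a`, which is in its own support, wins in the second path. -/
theorem support_ssubset (s : SuspData A) {N M₀ M₁ M₂ : ℕ} (h : N ≤ M₀) (h₀₁ : M₀ ≤ M₁)
    (h₁₂ : M₁ ≤ M₂) (hc₀ : s.Complete M₁ M₀) (hc₁ : s.Complete M₂ M₁) (a : A)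
    (hne : s.support N a M₀ ≠ Finset.univ) : s.support N a M₀ ⊂ s.support N a M₂ := by
  refine (s.support_mono h (h₀₁.trans h₁₂) a).ssubset_of_ne fun heq => ?_
  have hconst : ∀ i, M₀ ≤ i → i ≤ M₂ → s.support N a i = s.support N a M₀ := fun i h1 h2 =>
    ((s.support_mono (h.trans h1) h2 a).trans heq.ge).antisymm (s.support_mono h h1 a)
  obtain ⟨c, hc⟩ : ∃ c, c ∉ s.support N a M₀ := by
    by_contra! hall
    exact hne (Finset.eq_univ_iff_forall.2 hall)
  obtain ⟨i, hi0, hi1, rfl⟩ := hc₀ c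
  have hout : ∀ j, i ≤ j → j < M₂ → (s.back j).winner ∉ s.support N a M₀ := by
    intro j hij
    induction j, hij using Nat.le_induction with
    | base => exact fun _ => hc
    | succ j hj ih =>
      intro hj2 hmem
      have hw := ih (by omega)
      have e : (s.back (j + 1)).winner = _ := winner_backStep (s.back j)
      rw [e] at hmem
      split_ifs at hmem
      · exact hw hmem
      · rw [← hconst j (by omega) (by omega)] at hmem
        have := winner_mem_support (by omega) hmem
        rw [hconst (j + 1) (by omega) (by omega)] at this
        exact hw this
  obtain ⟨j, hj1, hj2, hj⟩ := hc₁ a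
  refine hout j (by omega) hj2 (s.support_mono le_rfl h a ?_)
  rw [hj, support_self]
  exact Finset.mem_singleton_self a

theorem Complete.mono {s : SuspData A} {M N M' N' : ℕ} (h : s.Complete M N) (hM : M ≤ M')
    (hN : N' ≤ N) : s.Complete M' N' := by
  intro a
  obtain ⟨i, h1, h2, h3⟩ := h a
  exact ⟨i, hN.trans h1, h2.trans_le hM, h3⟩

theorem accTime_spec {s : SuspData A} (hs : s.InfinitelyComplete) (k : ℕ) :
    s.accTime k < s.accTime (k + 1) ∧ s.Complete (s.accTime (k + 1)) (s.accTime k) := by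
  obtain ⟨t, hmono, -, hc⟩ := hs
  have h1 := hmono.id_le (s.accTime k)
  exact Nat.sInf_mem (s := {M : ℕ | s.accTime k < M ∧ s.Complete M (s.accTime k)})
    ⟨t (s.accTime k + 1), lt_of_le_of_lt h1 (hmono (Nat.lt_succ_self _)), (hc _).mono le_rfl h1⟩

theorem accTime_strictMono {s : SuspData A} (hs : s.InfinitelyComplete) : StrictMono s.accTime :=
  strictMono_nat_of_lt_succ fun k => (accTime_spec hs k).1

/-- Every two complete paths add a letter to the support of a row until it is full; `d` rounds
suffice. -/
theorem B_accTime_pos {s : SuspData A} (hs : s.InfinitelyComplete) (k : ℕ) (a b : A) :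
    0 < s.B (s.accTime (k + 2 * Fintype.card A)) (s.accTime k) a b := by
  have hmono := (accTime_strictMono hs).monotone
  have key : ∀ m, m < (s.support (s.accTime k) a (s.accTime (k + 2 * m))).card ∨
      s.support (s.accTime k) a (s.accTime (k + 2 * m)) = Finset.univ := by
    intro m
    induction m with
    | zero => left; simp [support_self]
    | succ m ih =>
      have h0 : s.accTime k ≤ s.accTime (k + 2 * m) := hmono (by omega)
      have h1 := accTime_spec hs (k + 2 * m)
      have h2 := accTime_spec hs (k + 2 * m + 1)
      by_cases h : s.support (s.accTime k) a (s.accTime (k + 2 * m)) = Finset.univ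
      · right
        exact Finset.univ_subset_iff.1 (h ▸ s.support_mono h0 (hmono (by omega)) a)
      · left
        have h3 := Finset.card_lt_card (s.support_ssubset h0 h1.1.le h2.1.le h1.2 h2.2 a h)
        have h4 := ih.resolve_right h
        rw [show k + 2 * (m + 1) = k + 2 * m + 1 + 1 by ring]
        omega
  have huniv := (key (Fintype.card A)).resolve_left (not_lt.2 (Finset.card_le_univ _))
  rw [← mem_support, huniv]
  exact Finset.mem_univ b

/-- The integer entries of the positive factor are at least `1`, so each column sum of the product
dominates the sum of all earlier column sums. -/
theorem norm_le_colSum_accTime {s : SuspData A} (hs : s.InfinitelyComplete) (k : ℕ) (b : A) :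
    matNorm (s.B (s.accTime k) 0) ≤ s.colSum (s.accTime (k + 2 * Fintype.card A)) b := by
  rw [norm_B_eq, ← Nat.cast_sum, colSum_mul s ((accTime_strictMono hs).monotone
    (Nat.le_add_right k (2 * Fintype.card A)))]
  refine Nat.cast_le.2 (Finset.sum_le_sum fun a _ => ?_)
  exact Nat.le_mul_of_pos_right _ (B_accTime_pos hs k a b)

end SuspData

/-! ### Balanced columns and small heights from the growth condition -/

variable {s : SuspData A}

theorem DualRoth.suspension_back (hs : DualRoth s) (N : ℕ) : (s.back N).IsSuspension :=
  hs.suspension.back hs.infinite N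

open SuspData

/-- The exponent is shared out as `√p * √p`, one factor for the first `m` complete paths and one for
the last path. -/
theorem DualRoth.exists_norm_accTime_add_le (hs : DualRoth s) (m : ℕ) :
    ∀ p : ℝ, 1 < p → ∃ C : ℝ, 0 < C ∧ ∀ k,
      matNorm (s.B (s.accTime (k + m)) 0) ≤ C * matNorm (s.B (s.accTime k) 0) ^ p := by
  induction m with
  | zero =>
    intro p hp
    refine ⟨1, one_pos, fun k => ?_⟩
    rw [one_mul]
    exact Real.self_le_rpow_of_one_le (s.one_le_norm_B _) hp.le
  | succ m ih =>
    intro p hp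
    have hr : 1 < √p := Real.lt_sqrt_of_sq_lt (by simpa using hp)
    obtain ⟨C₁, hC₁, h₁⟩ := ih (√p) hr
    obtain ⟨C₂, hC₂, h₂⟩ := hs.growth (√p - 1) (by linarith)
    refine ⟨C₂ * C₁ ^ √p, by positivity, fun k => ?_⟩
    set X := matNorm (s.B (s.accTime (k + m)) 0) with hX
    have hXpos : 0 < X := s.norm_B_pos _
    have hkpos := s.norm_B_pos (s.accTime k)
    rw [← Nat.add_assoc, B_mul s (Nat.zero_le (s.accTime (k + m)))
      (accTime_spec hs.complete (k + m)).1.le]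
    calc _ ≤ X * (C₂ * X ^ (√p - 1)) :=
          (matNorm_mul_le _ _).trans (mul_le_mul_of_nonneg_left (h₂ _) hXpos.le)
      _ = C₂ * X ^ √p := by
          rw [Real.rpow_sub_one hXpos.ne']; field_simp
      _ ≤ C₂ * (C₁ * matNorm (s.B (s.accTime k) 0) ^ √p) ^ √p := by
          gcongr
          exact h₁ k
      _ = _ := by
          rw [Real.mul_rpow hC₁.le (by positivity), ← Real.rpow_mul hkpos.le,
            Real.mul_self_sqrt (by linarith), mul_assoc]

/-- The columns of the matrices `B(n, 0)` have comparable sizes, up to small powers. -/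
theorem DualRoth.exists_norm_le_colSum (hs : DualRoth s) {p : ℝ} (hp : 1 < p) :
    ∃ C : ℝ, 0 < C ∧ ∀ N b, matNorm (s.B N 0) ≤ C * (s.colSum N b : ℝ) ^ p := by
  -- `2 * d` complete paths make the matrix positive; one more is needed to enclose an arbitrary
  -- time `N`.
  obtain ⟨C, hC, h⟩ := hs.exists_norm_accTime_add_le (2 * Fintype.card A + 1) p hp
  have hmono := accTime_strictMono hs.complete
  set C₀ := matNorm (s.B (s.accTime (2 * Fintype.card A)) 0)
  have hC₀ : 0 < C₀ := s.norm_B_pos _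
  refine ⟨C + C₀, by positivity, fun N b => ?_⟩
  have hcol : (1 : ℝ) ≤ s.colSum N b := by exact_mod_cast s.one_le_colSum N b
  have hcolp : (1 : ℝ) ≤ (s.colSum N b : ℝ) ^ p := Real.one_le_rpow hcol (by linarith)
  rcases le_total N (s.accTime (2 * Fintype.card A)) with hN | hN
  · calc matNorm (s.B N 0) ≤ C₀ := s.norm_B_mono hN
      _ ≤ (C + C₀) * 1 := by linarith
      _ ≤ _ := by gcongr
  · obtain ⟨k, hk1, hk2⟩ : ∃ k, s.accTime (k + 2 * Fintype.card A) ≤ N ∧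
        N ≤ s.accTime (k + (2 * Fintype.card A + 1)) := by
      by_contra! hcon
      have hall : ∀ k, s.accTime (k + 2 * Fintype.card A) ≤ N := by
        intro k
        induction k with
        | zero => simpa using hN
        | succ k ih =>
          have := (hcon k ih).le
          rwa [show k + 1 + 2 * Fintype.card A = k + (2 * Fintype.card A + 1) by ring]
      have h1 := hall (N + 1)
      have h2 := hmono.id_le (N + 1 + 2 * Fintype.card A)
      simp only [id] at h2
      omega
    calc matNorm (s.B N 0) ≤ matNorm (s.B (s.accTime (k + (2 * Fintype.card A + 1))) 0) :=
          s.norm_B_mono hk2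
      _ ≤ C * matNorm (s.B (s.accTime k) 0) ^ p := h k
      _ ≤ C * (s.colSum N b : ℝ) ^ p := by
          gcongr
          · exact (s.norm_B_pos _).le
          · refine (norm_le_colSum_accTime hs.complete k b).trans ?_
            exact_mod_cast s.colSum_mono b hk1
      _ ≤ _ := by gcongr; linarith

theorem DualRoth.exists_rpow_norm_le_colSum (hs : DualRoth s) {ε : ℝ} (hε : 0 < ε) :
    ∃ C : ℝ, 0 < C ∧ ∀ N b, matNorm (s.B N 0) ^ (1 - ε) ≤ C * (s.colSum N b : ℝ) := by
  set p := 1 + ε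
  have hp : 1 < p := by simp [p, hε]
  obtain ⟨C, hC, h⟩ := hs.exists_norm_le_colSum hp
  refine ⟨C ^ p⁻¹, by positivity, fun N b => ?_⟩
  have hx := s.one_le_norm_B N
  have hp0 : 0 < p := by linarith
  calc matNorm (s.B N 0) ^ (1 - ε) ≤ matNorm (s.B N 0) ^ p⁻¹ := by
        -- The comparison of exponents is `(1 - ε) * (1 + ε) ≤ 1`.
        refine Real.rpow_le_rpow_of_exponent_le hx ?_
        rw [← one_div, le_div_iff₀ hp0]
        nlinarith [sq_nonneg ε]
    _ ≤ (C * (s.colSum N b : ℝ) ^ p) ^ p⁻¹ := by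
        gcongr
        exact h N b
    _ = _ := by
        rw [Real.mul_rpow hC.le (by positivity), ← Real.rpow_mul (by positivity),
          mul_inv_cancel₀ hp0.ne', Real.rpow_one]

/-- The heights are bounded by nearly the inverse of the norm of `B(n, 0)`. -/
theorem DualRoth.exists_height_le (hs : DualRoth s) {ε : ℝ} (hε : 0 < ε) :
    ∃ C : ℝ, 0 < C ∧ ∀ N b, (s.back N).height b ≤ C * matNorm (s.B N 0) ^ (ε - 1) := by
  obtain ⟨C, hC, h⟩ := hs.exists_rpow_norm_le_colSum hε
  have hQ : 0 < ∑ a, s.height a := Finset.sum_pos (fun a _ => hs.suspension.height_pos a)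
    Finset.univ_nonempty
  refine ⟨C * ∑ a, s.height a, by positivity, fun N b => ?_⟩
  have hpos := fun b => (hs.suspension_back N).height_pos b
  have hx := s.norm_B_pos N
  -- The total height is the sum of column sums times heights at time `-N`, all terms being
  -- nonnegative; one term is kept.
  have h1 : (s.colSum N b : ℝ) * (s.back N).height b ≤ ∑ a, s.height a := by
    rw [height_eq_mulVec hs.suspension_back N]
    simp only [Matrix.mulVec, dotProduct]
    rw [Finset.sum_comm]
    simp only [← Finset.sum_mul]
    have : ∀ b, ∑ a, s.realB N a b = (s.colSum N b : ℝ) := by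
      intro b; simp [realB, colSum]
    simp only [this]
    exact Finset.single_le_sum (f := fun b => (s.colSum N b : ℝ) * (s.back N).height b)
      (fun b _ => mul_nonneg (Nat.cast_nonneg _) (hpos b).le) (Finset.mem_univ b)
  have h2 : matNorm (s.B N 0) ^ (1 - ε) * (s.back N).height b ≤ C * ∑ a, s.height a := by
    calc _ ≤ C * (s.colSum N b : ℝ) * (s.back N).height b :=
          mul_le_mul_of_nonneg_right (h N b) (hpos b).le
      _ = C * ((s.colSum N b : ℝ) * (s.back N).height b) := by ring
      _ ≤ _ := by gcongr
  rw [show ε - 1 = -(1 - ε) by ring, Real.rpow_neg hx.le, ← div_eq_mul_inv,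
    le_div_iff₀ (by positivity), mul_comm]
  exact h2

end RauzyVeech

namespace RauzyVeech

/-! ### Sums over the occurrences of a letter -/

section Lists

variable {A : Type*}

/-- The total length of a list of letters, the letter `b` having length `q b`. -/
def listLen (q : A → ℝ) (w : List A) : ℝ := (w.map q).sum

@[simp] theorem listLen_nil (q : A → ℝ) : listLen q [] = 0 := rfl

@[simp] theorem listLen_cons (q : A → ℝ) (b : A) (w : List A) :
    listLen q (b :: w) = q b + listLen q w := by simp [listLen]

theorem listLen_append (q : A → ℝ) (v w : List A) :
    listLen q (v ++ w) = listLen q v + listLen q w := by simp [listLen]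

theorem listLen_nonneg {q : A → ℝ} (hq : ∀ b, 0 < q b) (w : List A) : 0 ≤ listLen q w := by
  induction w with
  | nil => simp
  | cons b w ih => rw [listLen_cons]; linarith [hq b]

theorem listLen_flatMap {q q' : A → ℝ} {σ : A → List A} (h : ∀ b, listLen q' (σ b) = q b)
    (w : List A) : listLen q' (w.flatMap σ) = listLen q w := by
  induction w with
  | nil => rfl
  | cons b w ih => rw [List.flatMap_cons, listLen_append, ih, h, listLen_cons]

theorem listGraph_append (q χ : A → ℝ) (v w : List A) (x : ℝ) :
    listGraph q χ (v ++ w) x = listGraph q χ v x + listGraph q χ w (x - listLen q v) := by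
  induction v generalizing x with
  | nil => simp [listGraph]
  | cons b v ih => rw [List.cons_append, listGraph, ih, listGraph, listLen_cons, sub_sub, add_assoc]

theorem listGraph_of_nonpos {q : A → ℝ} (hq : ∀ b, 0 < q b) (χ : A → ℝ) (w : List A) {x : ℝ}
    (hx : x ≤ 0) : listGraph q χ w x = 0 := by
  induction w generalizing x with
  | nil => rfl
  | cons b w ih =>
    have h : x / q b ≤ 0 := div_nonpos_of_nonpos_of_nonneg hx (hq b).le
    rw [listGraph, ih (by linarith [hq b]), max_eq_left ((min_le_right _ _).trans h)]
    simp

theorem listGraph_of_ge {q : A → ℝ} (hq : ∀ b, 0 < q b) (χ : A → ℝ) (w : List A) {x : ℝ}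
    (hx : listLen q w ≤ x) : listGraph q χ w x = listLen χ w := by
  induction w generalizing x with
  | nil => rfl
  | cons b w ih =>
    rw [listLen_cons] at hx
    have h : 1 ≤ x / q b := by
      rw [one_le_div (hq b)]; linarith [listLen_nonneg hq w]
    rw [listGraph, ih (by linarith), min_eq_left h, listLen_cons]
    simp

theorem continuous_listGraph (q χ : A → ℝ) (w : List A) : Continuous (listGraph q χ w) := by
  induction w with
  | nil => exact continuous_const
  | cons b w ih =>
    have : Continuous fun x => listGraph q χ w (x - q b) := ih.comp (by fun_prop)
    change Continuous fun x => χ b * max 0 (min 1 (x / q b)) + listGraph q χ w (x - q b)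
    fun_prop

theorem abs_listGraph_le (q : A → ℝ) {χ : A → ℝ} {M : ℝ} (hM : ∀ b, |χ b| ≤ M) (w : List A)
    (x : ℝ) : |listGraph q χ w x| ≤ w.length * M := by
  induction w generalizing x with
  | nil => simp [listGraph]
  | cons b w ih =>
    have h1 : |χ b * max 0 (min 1 (x / q b))| ≤ M := by
      rw [abs_mul, abs_of_nonneg (le_max_left (0 : ℝ) (min 1 (x / q b)))]
      calc |χ b| * max 0 (min 1 (x / q b)) ≤ |χ b| * 1 := by
            gcongr
            exact max_le zero_le_one (min_le_left _ _)
        _ ≤ M := by rw [mul_one]; exact hM b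
    have h2 := ih (x - q b)
    rw [listGraph, List.length_cons]
    push_cast
    linarith [abs_add_le (χ b * max 0 (min 1 (x / q b))) (listGraph q χ w (x - q b))]

variable [DecidableEq A]

/-- The sum of `g` over the starting points of the pieces with letter `c`, the first piece
starting at `t`. -/
def occSum (q : A → ℝ) (c : A) : List A → ℝ → (ℝ → ℝ) → ℝ
  | [], _, _ => 0
  | b :: w, t, g => (if b = c then g t else 0) + occSum q c w (t + q b) g

theorem occSum_append (q : A → ℝ) (c : A) (v w : List A) (t : ℝ) (g : ℝ → ℝ) :
    occSum q c (v ++ w) t g = occSum q c v t g + occSum q c w (t + listLen q v) g := by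
  induction v generalizing t with
  | nil => simp [occSum]
  | cons b v ih => rw [List.cons_append, occSum, ih, occSum, listLen_cons]; ring_nf

theorem continuous_occSum (q : A → ℝ) (c : A) (w : List A) (t : ℝ) {g : ℝ → ℝ → ℝ}
    (hg : ∀ u, Continuous (g u)) : Continuous fun x => occSum q c w t fun u => g u x := by
  induction w generalizing t with
  | nil => exact continuous_const
  | cons b w ih =>
    have := ih (t + q b)
    have := hg t
    simp only [occSum]
    split_ifs <;> fun_prop

/-- Closeness to `m` is only required at starting points whose whole piece fits in the range, so
that translates by `y ≤ q c` remain inside a coarse piece. -/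
theorem abs_occSum_sub_le {q : A → ℝ} (hq : ∀ b, 0 < q b) (c : A) (w : List A) (t : ℝ)
    {g : ℝ → ℝ} {m ω : ℝ} (h : ∀ u, t ≤ u → u + q c ≤ t + listLen q w → |g u - m| ≤ ω) :
    |occSum q c w t g - w.count c * m| ≤ w.count c * ω := by
  induction w generalizing t with
  | nil => simp [occSum]
  | cons b w ih =>
    have ih' := ih (t + q b) fun u h1 h2 =>
      h u (by linarith [hq b]) (by rw [listLen_cons]; linarith)
    rw [occSum, List.count_cons]
    by_cases hb : b = c
    · subst hb
      have h0 := h t le_rfl (by rw [listLen_cons]; linarith [listLen_nonneg hq w])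
      simp only [if_true, beq_self_eq_true]
      push_cast
      rw [show g t + occSum q b w (t + q b) g - (w.count b + 1) * m =
        (g t - m) + (occSum q b w (t + q b) g - w.count b * m) by ring]
      linarith [abs_add_le (g t - m) (occSum q b w (t + q b) g - w.count b * m)]
    · simpa [hb] using ih'

/-- Refining the pieces changes the graph only inside each piece. -/
theorem listGraph_flatMap_sub {q q' χ χ' : A → ℝ} {σ : A → List A}
    (hlen : ∀ b, listLen q' (σ b) = q b) {l : A}
    (hσ : ∀ b, b ≠ l → σ b = [b] ∧ q' b = q b ∧ χ' b = χ b) (w : List A) (t x : ℝ) :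
    listGraph q' χ' (w.flatMap σ) (x - t) - listGraph q χ w (x - t) =
      occSum q l w t fun u => listGraph q' χ' (σ l) (x - u) - listGraph q χ [l] (x - u) := by
  induction w generalizing t with
  | nil => simp [listGraph, occSum]
  | cons b w ih =>
    have ih' := ih (t + q b)
    rw [← sub_sub] at ih'
    rw [List.flatMap_cons, listGraph_append, occSum, ← ih', hlen]
    by_cases hb : b = l
    · subst hb
      simp only [listGraph, if_true]
      ring
    · obtain ⟨h1, h2, h3⟩ := hσ b hb
      simp only [h1, listGraph, h2, h3, if_neg hb]
      ring

theorem integral_mul_translate {ψ D : ℝ → ℝ} {r t Q : ℝ} (ht : 0 ≤ t)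
    (htQ : t + r ≤ Q) (hD0 : ∀ y, y ≤ 0 → D y = 0) (hDr : ∀ y, r ≤ y → D y = 0) :
    ∫ x in (0 : ℝ)..Q, ψ x * D (x - t) = ∫ y in (0 : ℝ)..r, D y * ψ (t + y) := by
  have hsupp : Function.support (fun x => ψ x * D (x - t)) ⊆ Ioc t (t + r) := by
    intro x hx
    by_contra hcon
    apply hx
    have : D (x - t) = 0 := by
      by_cases h : x ≤ t
      · exact hD0 _ (by linarith)
      · refine hDr _ ?_
        by_contra h'
        exact hcon ⟨not_le.1 h, by linarith⟩
    simp [this]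
  rw [intervalIntegral.integral_eq_integral_of_support_subset
      (hsupp.trans (Ioc_subset_Ioc ht htQ)),
    ← intervalIntegral.integral_eq_integral_of_support_subset hsupp]
  have := intervalIntegral.integral_comp_add_left (a := 0) (b := r)
    (fun x => ψ x * D (x - t)) t
  rw [add_zero] at this
  rw [← this]
  refine intervalIntegral.integral_congr fun y _ => ?_
  simp only [add_sub_cancel_left]
  ring

/-- Each translate of `D` is supported in its own piece, and translation brings every piece back to
`[0, q l]`; the sum of translates moves from `D` to `ψ`. -/
theorem integral_mul_occSum {q : A → ℝ} (hq : ∀ b, 0 < q b) {ψ D : ℝ → ℝ} (hψ : Continuous ψ)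
    (hD : Continuous D) {l : A} (hD0 : ∀ y, y ≤ 0 → D y = 0) (hDr : ∀ y, q l ≤ y → D y = 0)
    (w : List A) {t Q : ℝ} (ht : 0 ≤ t) (htQ : t + listLen q w ≤ Q) :
    ∫ x in (0 : ℝ)..Q, ψ x * occSum q l w t (fun u => D (x - u)) =
      ∫ y in (0 : ℝ)..(q l), D y * occSum q l w t fun u => ψ (u + y) := by
  induction w generalizing t with
  | nil => simp [occSum]
  | cons b w ih =>
    rw [listLen_cons] at htQ
    have ih' := ih (t := t + q b) (by linarith [hq b]) (by linarith)
    have hc1 : Continuous fun x => occSum q l w (t + q b) fun u => D (x - u) :=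
      continuous_occSum q l w _ fun u => by fun_prop
    have hc2 : Continuous fun y => occSum q l w (t + q b) fun u => ψ (u + y) :=
      continuous_occSum q l w _ fun u => by fun_prop
    by_cases hb : b = l
    · subst hb
      simp only [occSum, if_true, mul_add]
      rw [intervalIntegral.integral_add, intervalIntegral.integral_add, ih',
        integral_mul_translate ht (by linarith [listLen_nonneg hq w]) hD0 hDr]
      all_goals exact Continuous.intervalIntegrable (by fun_prop) _ _
    · simpa only [occSum, if_neg hb, zero_add] using ih'

/-! ### Comparison of a sum over occurrences with block averages -/

/-- The sum of the averages of `ψ` over the pieces with letter `b`. -/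
def avgSum (q : A → ℝ) (ψ : ℝ → ℝ) (w : List A) (t : ℝ) (b : A) : ℝ :=
  occSum q b w t fun u => (q b)⁻¹ * ∫ x in u..(u + q b), ψ x

theorem abs_sub_average_le {ψ : ℝ → ℝ} (hψ : Continuous ψ) {u r z ω : ℝ} (hr : 0 < r)
    (h : ∀ x ∈ Icc u (u + r), |ψ z - ψ x| ≤ ω) :
    |ψ z - r⁻¹ * ∫ x in u..(u + r), ψ x| ≤ ω := by
  have e : ψ z - r⁻¹ * ∫ x in u..(u + r), ψ x = r⁻¹ * ∫ x in u..(u + r), (ψ z - ψ x) := by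
    rw [intervalIntegral.integral_sub (by simp) (hψ.intervalIntegrable _ _),
      intervalIntegral.integral_const]
    simp only [add_sub_cancel_left, smul_eq_mul]
    field_simp
  have h1 : ‖∫ x in u..(u + r), (ψ z - ψ x)‖ ≤ ω * |u + r - u| := by
    refine intervalIntegral.norm_integral_le_of_norm_le_const fun x hx => ?_
    rw [uIoc_of_le (by linarith)] at hx
    exact h x (Ioc_subset_Icc_self hx)
  rw [add_sub_cancel_left, abs_of_pos hr, Real.norm_eq_abs] at h1
  rw [e, abs_mul, abs_of_pos (inv_pos.2 hr), inv_mul_le_iff₀ hr]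
  linarith

theorem abs_average_le {ψ : ℝ → ℝ} {K u r : ℝ} (hr : 0 < r) (h : ∀ x, |ψ x| ≤ K) :
    |r⁻¹ * ∫ x in u..(u + r), ψ x| ≤ K := by
  have h1 : ‖∫ x in u..(u + r), ψ x‖ ≤ K * |u + r - u| :=
    intervalIntegral.norm_integral_le_of_norm_le_const fun x _ => h x
  rw [add_sub_cancel_left, abs_of_pos hr, Real.norm_eq_abs] at h1
  rw [abs_mul, abs_of_pos (inv_pos.2 hr), inv_mul_le_iff₀ hr]
  linarith

theorem abs_avgSum_le {q : A → ℝ} (hq : ∀ b, 0 < q b) {ψ : ℝ → ℝ} {K : ℝ} (h : ∀ x, |ψ x| ≤ K)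
    (w : List A) (t : ℝ) (b : A) : |avgSum q ψ w t b| ≤ w.count b * K := by
  simpa [avgSum] using abs_occSum_sub_le hq b w t (m := 0) (ω := K)
    (g := fun u => (q b)⁻¹ * ∫ x in u..(u + q b), ψ x)
    (fun u _ _ => by simpa using abs_average_le (u := u) (hq b) h)

variable [Fintype A]

/-- The weights undo the normalisation of the averages, and the pieces tile the interval. Mean zero
of `ψ` thus becomes orthogonality to the height vector. -/
theorem sum_mul_avgSum {q : A → ℝ} (hq : ∀ b, 0 < q b) {ψ : ℝ → ℝ} (hψ : Continuous ψ)
    (w : List A) (t : ℝ) : ∑ b, q b * avgSum q ψ w t b = ∫ x in t..(t + listLen q w), ψ x := by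
  induction w generalizing t with
  | nil => simp [avgSum, occSum]
  | cons c w ih =>
    have ih' := ih (t + q c)
    simp only [avgSum] at ih'
    simp only [avgSum, occSum, mul_add, Finset.sum_add_distrib, ih', listLen_cons, mul_ite,
      mul_zero, Finset.sum_ite_eq, Finset.mem_univ, if_true]
    rw [mul_inv_cancel_left₀ (hq c).ne', ← add_assoc,
      intervalIntegral.integral_add_adjacent_intervals] <;>
    exact hψ.intervalIntegrable _ _

/-- All occurrences of `c` inside one coarse piece are replaced by the average of `ψ` over that
piece, at a cost of at most `ω` each. -/
theorem abs_occSum_flatMap_sub_le {q q' : A → ℝ} (hq : ∀ b, 0 < q b) (hq' : ∀ b, 0 < q' b)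
    {σ : A → List A} (hlen : ∀ b, listLen q (σ b) = q' b) {ψ : ℝ → ℝ} (hψ : Continuous ψ) {ω : ℝ}
    (hω : ∀ b x y, |x - y| ≤ q' b → |ψ x - ψ y| ≤ ω) (c : A) {y : ℝ} (hy : y ∈ Icc 0 (q c))
    (w : List A) (t : ℝ) :
    |occSum q c (w.flatMap σ) t (fun u => ψ (u + y)) -
        ∑ b, (σ b).count c * avgSum q' ψ w t b| ≤ (w.flatMap σ).count c * ω := by
  induction w generalizing t with
  | nil => simp [occSum, avgSum]
  | cons a w ih =>
    have ih' := ih (t + q' a)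
    have hhead := abs_occSum_sub_le hq c (σ a) t (g := fun u => ψ (u + y))
      (m := (q' a)⁻¹ * ∫ x in t..(t + q' a), ψ x) (ω := ω) fun u h1 h2 => by
        rw [hlen] at h2
        refine abs_sub_average_le hψ (hq' a) fun x hx => hω a _ _ ?_
        rw [abs_le]
        constructor <;> linarith [hy.1, hy.2, hx.1, hx.2]
    have hsum : ∑ b, (σ b).count c * avgSum q' ψ (a :: w) t b =
        (σ a).count c * ((q' a)⁻¹ * ∫ x in t..(t + q' a), ψ x) +
          ∑ b, (σ b).count c * avgSum q' ψ w (t + q' a) b := by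
      simp only [avgSum, occSum, mul_add, Finset.sum_add_distrib, mul_ite, mul_zero,
        Finset.sum_ite_eq, Finset.mem_univ, if_true]
    rw [List.flatMap_cons, occSum_append, hlen, hsum, List.count_append, add_sub_add_comm]
    push_cast
    rw [add_mul]
    exact (abs_add_le _ _).trans (add_le_add hhead ih')

end Lists

end RauzyVeech

/-! ### Cancellation in sums over occurrences, from the spectral gap -/

namespace RauzyVeech

variable {A : Type*} [Fintype A] [Nontrivial A] [DecidableEq A] {s : SuspData A}

open SuspData

/-- With determinant `1` the inverse is the adjugate, whose entries are determinants. The bound `1 ≤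
x` covers the row of zeros and a one in them. -/
theorem abs_inv_mulVec_le {A : Type*} [Fintype A] [DecidableEq A] {M : Matrix A A ℝ} (hdet : M.det = 1)
    {x K : ℝ} (hx : 1 ≤ x) (hM : ∀ a b, |M a b| ≤ x) {v : A → ℝ} (hv : ∀ b, |v b| ≤ K) (a : A) :
    |(M⁻¹ *ᵥ v) a| ≤ Fintype.card A * ((Fintype.card A).factorial * x ^ Fintype.card A * K) := by
  have hinv : M⁻¹ = M.adjugate := by rw [Matrix.inv_def, hdet]; simp
  have hadj : ∀ i j, |M.adjugate i j| ≤ (Fintype.card A).factorial * x ^ Fintype.card A := by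
    intro i j
    rw [Matrix.adjugate_apply, ← nsmul_eq_mul]
    refine Matrix.det_le (abv := AbsoluteValue.abs) fun k l => ?_
    rw [AbsoluteValue.abs_apply, Matrix.updateRow_apply]
    split_ifs
    · rw [Pi.single_apply]
      split_ifs <;> simp <;> linarith
    · exact hM k l
  rw [hinv, Matrix.mulVec, dotProduct]
  calc |∑ b, M.adjugate a b * v b| ≤ ∑ b, |M.adjugate a b * v b| := Finset.abs_sum_le_sum_abs _ _
    _ ≤ ∑ _b : A, (Fintype.card A).factorial * x ^ Fintype.card A * K := by
        refine Finset.sum_le_sum fun b _ => ?_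
        rw [abs_mul]
        exact mul_le_mul (hadj a b) (hv b) (abs_nonneg _) (by positivity)
    _ = _ := by rw [Finset.sum_const, Finset.card_univ, nsmul_eq_mul]

namespace SuspData

theorem listLen_sub_height (hs : s.IsSuspension) (b : A) :
    listLen s.backStep.height (s.sub b) = s.height b := by
  rw [sub]
  split_ifs with hb ht
  · subst hb; simp [height_loser hs]
  · subst hb; simp [height_loser hs, add_comm]
  · simp [height_backStep_of_ne hs hb]

theorem listLen_word_height (hs : ∀ N, (s.back N).IsSuspension) (M N : ℕ) (b : A) :
    listLen (s.back (M + N)).height ((s.back M).word N b) = (s.back M).height b := by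
  induction N with
  | zero => simp [word]
  | succ N ih =>
    rw [word, ← back_add, listLen_flatMap (q := (s.back (M + N)).height), ih]
    exact fun b => listLen_sub_height (hs (M + N)) b

/-- The letter counts are the entries of `B(-(M + N), -M)`; weighting a vector already transported
to time `-M` by them yields the full transpose, to which the spectral gap applies. -/
theorem realB_transpose_mulVec (hs : ∀ N, (s.back N).IsSuspension) {M N : ℕ} (f : A → ℝ) (c : A) :
    ((s.realB (M + N))ᵀ *ᵥ f) c =
      ∑ b, (((s.back M).word N b).count c : ℝ) * ((s.realB M)ᵀ *ᵥ f) b := by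
  have hs' : ∀ K, ((s.back M).back K).IsSuspension := fun K => by rw [← back_add]; exact hs _
  have : s.realB (M + N) = s.realB M * (s.back M).realB N := by
    rw [realB, B_mul s (Nat.zero_le M) (Nat.le_add_right M N), Matrix.map_mul_natCast, ← B_back,
      realB, realB]
  rw [this, Matrix.transpose_mul, ← Matrix.mulVec_mulVec]
  simp only [Matrix.mulVec, dotProduct, count_word hs', realB, Matrix.transpose_apply,
    Matrix.map_apply]

end SuspData

/-- Two-scale bound for the sums of a Hölder function of mean zero over the occurrences of a letter
in an itinerary. -/
theorem DualRoth.exists_abs_occSum_le_two_scales (hs : DualRoth s) {η : ℝ} (hη : 0 < η) :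
    ∃ θ : ℝ, 0 < θ ∧ ∃ C : ℝ, 0 < C ∧ ∀ (K : ℝ) (ψ : ℝ → ℝ), Continuous ψ → (∀ x, |ψ x| ≤ K) →
      (∀ x y, |ψ x - ψ y| ≤ K * |x - y| ^ η) → ∀ α, (∫ x in (0 : ℝ)..(s.height α), ψ x) = 0 →
      ∀ (M N : ℕ) (h : ℝ), M ≤ N → (∀ b, (s.back M).height b ≤ h) →
      ∀ c, ∀ y ∈ Icc 0 ((s.back N).height c),
        |occSum (s.back N).height c (s.word N α) 0 fun u => ψ (u + y)| ≤
          K * (C * matNorm (s.B N 0) ^ (1 - θ) * matNorm (s.B M 0) ^ (Fintype.card A + 1) +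
            h ^ η * matNorm (s.B N 0)) := by
  obtain ⟨θ, hθ, C, hC, hgap⟩ := hs.gap
  have hsb := hs.suspension_back
  set d := Fintype.card A
  refine ⟨θ, hθ, C * (d * d.factorial), by positivity, ?_⟩
  intro K ψ hψ hψK hψη α hint M N h hMN hh c y hy
  obtain ⟨J, rfl⟩ := Nat.exists_eq_add_of_le hMN
  have hK : 0 ≤ K := (abs_nonneg _).trans (hψK 0)
  have hqM := fun b => (hsb M).height_pos b
  have hqN := fun b => (hsb (M + J)).height_pos b
  set X := matNorm (s.B M 0)
  set Y := matNorm (s.B (M + J) 0)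
  have hX : 1 ≤ X := s.one_le_norm_B M
  have hY : 1 ≤ Y := s.one_le_norm_B _
  set V := avgSum (s.back M).height ψ (s.word M α) 0
  have hV : ∀ b, |V b| ≤ X * K := fun b => by
    refine (abs_avgSum_le hqM hψK _ _ _).trans ?_
    rw [count_word hsb]
    exact mul_le_mul_of_nonneg_right (le_matNorm _ _ _) hK
  -- Pulling the averages back to time `0` puts them where the spectral gap is stated; the inverse
  -- only costs a power of `X`, the norm at the coarse time.
  set f := ((s.realB M)ᵀ)⁻¹ *ᵥ V
  have hdet : ((s.realB M)ᵀ).det = 1 := by rw [Matrix.det_transpose, det_realB hsb]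
  have hf : (s.realB M)ᵀ *ᵥ f = V := by
    rw [Matrix.mulVec_mulVec, Matrix.mul_nonsing_inv _ (by rw [hdet]; exact isUnit_one),
      Matrix.one_mulVec]
  have hfnorm : ‖f‖ ≤ d * (d.factorial * X ^ d * (X * K)) := by
    refine (pi_norm_le_iff_of_nonneg (by positivity)).2 fun a => ?_
    refine abs_inv_mulVec_le hdet hX (fun a b => ?_) hV a
    rw [Matrix.transpose_apply, realB, Matrix.map_apply, Nat.abs_cast]
    exact le_matNorm _ _ _
  -- The pairing of heights with vectors is invariant under the cocycle, so it may be computed at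
  -- time `-M`.
  have hzero : ∑ a, s.height a * f a = 0 := by
    have e1 : ∑ b, (s.back M).height b * V b = 0 := by
      have hw : listLen (s.back M).height (s.word M α) = s.height α := by
        have := listLen_word_height hsb 0 M α
        rwa [Nat.zero_add] at this
      rw [sum_mul_avgSum hqM hψ, hw, zero_add]
      exact hint
    have e2 : ∑ a, s.height a * f a = s.height ⬝ᵥ f := rfl
    rw [e2, height_eq_mulVec hsb M, ← Matrix.vecMul_transpose, ← Matrix.dotProduct_mulVec, hf]
    exact e1
  have hmain : |∑ b, (((s.back M).word J b).count c : ℝ) * V b| ≤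
      C * Y ^ (1 - θ) * (d * (d.factorial * X ^ d * (X * K))) := by
    rw [← hf, ← realB_transpose_mulVec hsb]
    calc _ ≤ ‖(s.realB (M + J))ᵀ *ᵥ f‖ := norm_le_pi_norm ((s.realB (M + J))ᵀ *ᵥ f) c
      _ ≤ C * Y ^ (1 - θ) * ‖f‖ := hgap (M + J) f hzero
      _ ≤ _ := by gcongr
  have herr := abs_occSum_flatMap_sub_le hqN hqM (fun b => listLen_word_height hsb M J b) hψ
    (ω := K * h ^ η) (fun b x y hxy => (hψη x y).trans (by gcongr; exact hxy.trans (hh b)))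
    c hy (s.word M α) 0
  rw [← word_add, count_word hsb] at herr
  have hcount : ((s.B (M + J) 0 α c : ℕ) : ℝ) * (K * h ^ η) ≤ Y * (K * h ^ η) := by
    have : 0 ≤ h := (hqM c).le.trans (hh c)
    gcongr
    exact le_matNorm _ _ _
  have htri := abs_sub_abs_le_abs_sub
    (occSum (s.back (M + J)).height c (s.word (M + J) α) 0 fun u => ψ (u + y))
    (∑ b, (((s.back M).word J b).count c : ℝ) * V b)
  calc _ ≤ Y * (K * h ^ η) + C * Y ^ (1 - θ) * (d * (d.factorial * X ^ d * (X * K))) := by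
        linarith
    _ = _ := by ring

theorem SuspData.exists_norm_B_between (s : SuspData A) (N : ℕ) {κ : ℝ} (hκ0 : 0 ≤ κ)
    (hκ : κ ≤ 1) : ∃ M ≤ N, matNorm (s.B N 0) ^ κ ≤ 2 * matNorm (s.B M 0) ∧
      matNorm (s.B M 0) ≤ Fintype.card A * matNorm (s.B N 0) ^ κ := by
  classical
  have hx := s.one_le_norm_B N
  have hd : (1 : ℝ) ≤ Fintype.card A := by exact_mod_cast Nat.succ_le_of_lt Fintype.card_pos
  -- The factor `d` is the norm at time `0`, so that `P 0` holds; for the last `M` satisfying `P`,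
  -- the lower bound follows since one step at most doubles the norm.
  set P : ℕ → Prop := fun M => matNorm (s.B M 0) ≤ Fintype.card A * matNorm (s.B N 0) ^ κ
  have h0 : P 0 := by
    simp only [P, norm_B_zero]
    exact le_mul_of_one_le_right (by linarith) (Real.one_le_rpow hx hκ0)
  refine ⟨Nat.findGreatest P N, Nat.findGreatest_le N, ?_, Nat.findGreatest_spec (Nat.zero_le N) h0⟩
  rcases (Nat.findGreatest_le (P := P) N).eq_or_lt with h | h
  · rw [h]
    calc matNorm (s.B N 0) ^ κ ≤ matNorm (s.B N 0) ^ (1 : ℝ) :=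
          Real.rpow_le_rpow_of_exponent_le hx hκ
      _ ≤ _ := by rw [Real.rpow_one]; linarith
  · have h1 : ¬ P (Nat.findGreatest P N + 1) := Nat.findGreatest_is_greatest (Nat.lt_succ_self _) h
    refine le_trans ?_ ((not_le.1 h1).le.trans (s.norm_B_succ_le _))
    exact le_mul_of_one_le_left (by positivity) hd

/-- Sums of a Hölder function of mean zero over the occurrences of a letter grow slower than the
number of occurrences. -/
theorem DualRoth.exists_abs_occSum_le (hs : DualRoth s) {η : ℝ} (hη : 0 < η) :
    ∃ δ : ℝ, 0 < δ ∧ ∃ C : ℝ, 0 < C ∧ ∀ (K : ℝ) (ψ : ℝ → ℝ), Continuous ψ → (∀ x, |ψ x| ≤ K) →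
      (∀ x y, |ψ x - ψ y| ≤ K * |x - y| ^ η) → ∀ α, (∫ x in (0 : ℝ)..(s.height α), ψ x) = 0 →
      ∀ (N : ℕ) (c : A), ∀ y ∈ Icc 0 ((s.back N).height c),
        |occSum (s.back N).height c (s.word N α) 0 fun u => ψ (u + y)| ≤
          C * K * matNorm (s.B N 0) ^ (1 - δ) := by
  obtain ⟨θ, hθ, C, hC, h2⟩ := hs.exists_abs_occSum_le_two_scales hη
  obtain ⟨C', hC', hq⟩ := hs.exists_height_le (ε := 1 / 2) (by norm_num)
  set d := Fintype.card A
  have hd : (0 : ℝ) < d + 1 := by positivity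
  -- The power `d + 1` of the coarse norm then uses at most half of the gap `θ`.
  set κ := min 1 (θ / (2 * (d + 1)))
  have hκ0 : 0 < κ := lt_min one_pos (by positivity)
  have hκ1 : κ ≤ 1 := min_le_left _ _
  have hκ2 : κ * (d + 1) ≤ θ / 2 := by
    calc κ * (d + 1) ≤ θ / (2 * (d + 1)) * (d + 1) := by gcongr; exact min_le_right _ _
      _ = θ / 2 := by field_simp
  -- The second term is the Hölder gain: coarse heights are at most about `Y ^ (-κ / 2)`, by the
  -- height bound with `ε = 1 / 2`.
  set δ := min (θ / 2) (κ * η / 2)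
  have hδ1 : δ ≤ θ / 2 := min_le_left _ _
  have hδ2 : δ ≤ κ * η / 2 := min_le_right _ _
  refine ⟨δ, lt_min (by positivity) (by positivity),
    C * d ^ (d + 1) + (C' * 2 ^ (1 / 2 : ℝ)) ^ η, by positivity, ?_⟩
  intro K ψ hψ hψK hψη α hint N c y hy
  have hK : 0 ≤ K := (abs_nonneg _).trans (hψK 0)
  obtain ⟨M, hMN, hM1, hM2⟩ := s.exists_norm_B_between N hκ0.le hκ1
  have hX := s.norm_B_pos M
  have hY1 := s.one_le_norm_B N
  refine (h2 K ψ hψ hψK hψη α hint M N _ hMN (hq M) c y hy).trans ?_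
  set X := matNorm (s.B M 0)
  set Y := matNorm (s.B N 0)
  have hY : 0 < Y := by linarith
  have t1 : C * Y ^ (1 - θ) * X ^ (d + 1) ≤ C * d ^ (d + 1) * Y ^ (1 - δ) := by
    calc C * Y ^ (1 - θ) * X ^ (d + 1) ≤ C * Y ^ (1 - θ) * (d * Y ^ κ) ^ (d + 1) := by gcongr
      _ = C * d ^ (d + 1) * Y ^ (1 - θ + κ * (d + 1)) := by
          rw [mul_pow, Real.rpow_add hY, ← Real.rpow_natCast (Y ^ κ), ← Real.rpow_mul hY.le]
          push_cast; ring
      _ ≤ _ := by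
          gcongr
          linarith
  have t2 : (C' * X ^ (1 / 2 - 1 : ℝ)) ^ η * Y ≤ (C' * 2 ^ (1 / 2 : ℝ)) ^ η * Y ^ (1 - δ) := by
    have e1 : X ^ (1 / 2 - 1 : ℝ) ≤ 2 ^ (1 / 2 : ℝ) * Y ^ (-(κ / 2)) := by
      calc X ^ (1 / 2 - 1 : ℝ) ≤ (Y ^ κ / 2) ^ (1 / 2 - 1 : ℝ) :=
            Real.rpow_le_rpow_of_nonpos (by positivity) (by linarith) (by norm_num)
        _ = _ := by
            rw [Real.div_rpow (by positivity) (by norm_num), ← Real.rpow_mul hY.le, div_eq_mul_inv,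
              ← Real.rpow_neg (by norm_num), mul_comm]
            ring_nf
    calc (C' * X ^ (1 / 2 - 1 : ℝ)) ^ η * Y
        ≤ (C' * (2 ^ (1 / 2 : ℝ) * Y ^ (-(κ / 2)))) ^ η * Y := by gcongr
      _ = (C' * 2 ^ (1 / 2 : ℝ)) ^ η * Y ^ (1 - κ * η / 2) := by
          rw [← mul_assoc, Real.mul_rpow (by positivity) (by positivity), ← Real.rpow_mul hY.le,
            sub_eq_neg_add, Real.rpow_add hY, Real.rpow_one, mul_assoc]
          ring_nf
      _ ≤ _ := by
          gcongr
  calc _ ≤ K * (C * d ^ (d + 1) * Y ^ (1 - δ) + (C' * 2 ^ (1 / 2 : ℝ)) ^ η * Y ^ (1 - δ)) := by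
        gcongr
    _ = _ := by ring

end RauzyVeech

/-! ### The cost of one step and its summation -/

namespace RauzyVeech

/-- Extending by the endpoint values keeps both bounds, because the projection onto the interval is
`1`-Lipschitz. The estimates can then be run with functions defined on the whole line. -/
theorem holderNorm_spec {η : ℝ≥0} (hη : 0 < η) {q : ℝ} (hq : 0 ≤ q) {ψ : ℝ → ℝ}
    (hψ : MemHolder η ((Icc (0 : ℝ) q).domRestrict ψ)) :
    ∃ g : ℝ → ℝ, Continuous g ∧ EqOn g ψ (Icc 0 q) ∧ (∀ x, |g x| ≤ holderNorm η q ψ) ∧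
      ∀ x y, |g x - g y| ≤ holderNorm η q ψ * |x - y| ^ (η : ℝ) := by
  set r := (Icc (0 : ℝ) q).domRestrict ψ with hr
  have hH := hψ.holderWith
  have hcont : Continuous r := hH.continuous hη
  have hbdd : BddAbove (range fun x : Icc (0 : ℝ) q => |ψ x|) :=
    (isCompact_range (f := fun x : Icc (0 : ℝ) q => |r x|) hcont.abs).bddAbove
  have hsup : ∀ x : Icc (0 : ℝ) q, |r x| ≤ ⨆ x : Icc (0 : ℝ) q, |ψ x| := fun x => le_ciSup hbdd x
  have hsup0 : 0 ≤ ⨆ x : Icc (0 : ℝ) q, |ψ x| := Real.iSup_nonneg fun _ => abs_nonneg _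
  refine ⟨IccExtend hq r, hcont.Icc_extend', fun x hx => ?_, fun x => ?_, fun x y => ?_⟩
  · rw [IccExtend_of_mem _ _ hx]; rfl
  · exact (hsup _).trans (le_add_of_nonneg_right (NNReal.coe_nonneg _))
  · have h1 := hH.dist_le (projIcc 0 q hq x) (projIcc 0 q hq y)
    have h2 : dist (projIcc 0 q hq x) (projIcc 0 q hq y) ≤ |x - y| := abs_projIcc_sub_projIcc hq
    calc |IccExtend hq r x - IccExtend hq r y|
        ≤ nnHolderNorm η r * dist (projIcc 0 q hq x) (projIcc 0 q hq y) ^ (η : ℝ) := h1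
      _ ≤ holderNorm η q ψ * |x - y| ^ (η : ℝ) := by
        gcongr
        · exact add_nonneg hsup0 (NNReal.coe_nonneg _)
        · exact le_add_of_nonneg_left hsup0

/-- With `t = l / x ≤ 1`, one has `log (1 + t) ≥ t / 2`, hence `(1 + t) ^ γ ≥ 1 + γ * t / 2`, and `1
- (1 + γ * t / 2)⁻¹ ≥ γ * t / (2 + γ)`. -/
theorem rpow_neg_sub_ge {x l γ : ℝ} (hx : 0 < x) (hl : 0 ≤ l) (hlx : l ≤ x) (hγ : 0 < γ) :
    γ / (2 + γ) * (x ^ (-γ) * (l / x)) ≤ x ^ (-γ) - (x + l) ^ (-γ) := by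
  set t := l / x
  have ht0 : 0 ≤ t := by positivity
  have ht1 : t ≤ 1 := (div_le_one hx).2 hlx
  have e : x + l = x * (1 + t) := by simp only [t]; field_simp
  have hlog : t / 2 ≤ Real.log (1 + t) := by
    refine le_trans ?_ (Real.one_sub_inv_le_log_of_pos (by linarith))
    rw [← one_div, one_sub_div (by linarith), div_le_div_iff₀ (by norm_num) (by linarith)]
    nlinarith
  have hpow : (1 + t) ^ (-γ) ≤ (1 + γ * t / 2)⁻¹ := by
    rw [Real.rpow_neg (by linarith)]
    refine inv_anti₀ (by positivity) ?_
    rw [Real.rpow_def_of_pos (by linarith)]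
    nlinarith [Real.add_one_le_exp (Real.log (1 + t) * γ)]
  have h1 : γ / (2 + γ) * t ≤ 1 - (1 + γ * t / 2)⁻¹ := by
    have hu : 0 < 1 + γ * t / 2 := by positivity
    rw [← one_div, one_sub_div hu.ne', div_mul_eq_mul_div, div_le_div_iff₀ (by linarith) hu]
    nlinarith [mul_nonneg hγ.le ht0, mul_nonneg (mul_nonneg hγ.le ht0) (mul_nonneg hγ.le
      (sub_nonneg.2 ht1))]
  rw [e, Real.mul_rpow hx.le (by linarith)]
  calc γ / (2 + γ) * (x ^ (-γ) * t) = x ^ (-γ) * (γ / (2 + γ) * t) := by ring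
    _ ≤ x ^ (-γ) * (1 - (1 + t) ^ (-γ)) := by gcongr; linarith
    _ = _ := by ring

variable {A : Type*} [Fintype A] [Nontrivial A] [DecidableEq A] {s : SuspData A}

open SuspData

/-- The norm grows in one step by the column sum of the loser, which is at least a constant times
the norm to the power `1 - ε`. This makes the step bounds telescope. -/
theorem DualRoth.exists_rpow_le_sub (hs : DualRoth s) {γ ε : ℝ} (hγ : 0 < γ) (hε : 0 < ε) :
    ∃ C : ℝ, 0 < C ∧ ∀ N, matNorm (s.B N 0) ^ (-γ - ε) ≤
      C * (matNorm (s.B N 0) ^ (-γ) - matNorm (s.B (N + 1) 0) ^ (-γ)) := by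
  obtain ⟨C, hC, h⟩ := hs.exists_rpow_norm_le_colSum hε
  refine ⟨C * ((2 + γ) / γ), by positivity, fun N => ?_⟩
  have hx := s.norm_B_pos N
  have h1 := rpow_neg_sub_ge hx (Nat.cast_nonneg (s.colSum N (s.back N).loser))
    (s.colSum_le_norm N _) hγ
  have h2 := h N (s.back N).loser
  rw [norm_B_succ]
  set x := matNorm (s.B N 0)
  set l : ℝ := (s.colSum N (s.back N).loser : ℝ)
  calc x ^ (-γ - ε) = x ^ (-γ) * (x ^ (1 - ε) / x) := by
        rw [Real.rpow_sub hx, Real.rpow_sub hx, Real.rpow_one]; field_simp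
    _ ≤ x ^ (-γ) * (C * l / x) := by gcongr
    _ = C * ((2 + γ) / γ) * (γ / (2 + γ) * (x ^ (-γ) * (l / x))) := by field_simp
    _ ≤ _ := by gcongr

namespace SuspData

/-- The graph of the Birkhoff sums at time `-N`, in terms of the itinerary of the letter `α`. -/
def wordGraph (s : SuspData A) (χ : A → ℝ) (N : ℕ) (α : A) : ℝ → ℝ :=
  listGraph (s.back N).height (s.pull χ N) (s.word N α)

/-- The change, inside a piece of the loser, of the graph of the Birkhoff sums in one step. -/
def bump (s : SuspData A) (χ : A → ℝ) (N : ℕ) (y : ℝ) : ℝ :=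
  listGraph (s.back (N + 1)).height (s.pull χ (N + 1)) ((s.back N).sub (s.back N).loser) y -
    listGraph (s.back N).height (s.pull χ N) [(s.back N).loser] y

theorem wordGraph_succ_sub (hs : ∀ N, (s.back N).IsSuspension) (χ : A → ℝ) (N : ℕ) (α : A)
    (x : ℝ) : s.wordGraph χ (N + 1) α x - s.wordGraph χ N α x =
      occSum (s.back N).height (s.back N).loser (s.word N α) 0 fun u => s.bump χ N (x - u) := by
  have h := listGraph_flatMap_sub (χ := s.pull χ N) (χ' := s.pull χ (N + 1))
    (fun b => listLen_sub_height (hs N) b) (l := (s.back N).loser)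
    (fun b hb => ⟨if_neg hb, height_backStep_of_ne (hs N) hb, by simp [pull_eq hs χ N b, hb]⟩)
    (s.word N α) 0 x
  rw [sub_zero] at h
  exact h

theorem listLen_sub_pull (hs : ∀ N, (s.back N).IsSuspension) (χ : A → ℝ) (N : ℕ) (b : A) :
    listLen (s.pull χ (N + 1)) ((s.back N).sub b) = s.pull χ N b := by
  rw [sub, pull_eq hs χ N b]
  split_ifs with hb ht
  · subst hb; simp
  · subst hb; simp [add_comm]
  · simp

theorem bump_of_nonpos (hs : ∀ N, (s.back N).IsSuspension) (χ : A → ℝ) (N : ℕ) {y : ℝ}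
    (hy : y ≤ 0) : s.bump χ N y = 0 := by
  rw [bump, listGraph_of_nonpos (fun b => (hs (N + 1)).height_pos b) _ _ hy,
    listGraph_of_nonpos (fun b => (hs N).height_pos b) _ _ hy, sub_zero]

/-- Cutting the piece of the loser preserves both its total length and its total increment, so the
two graphs agree beyond it. -/
theorem bump_of_ge (hs : ∀ N, (s.back N).IsSuspension) (χ : A → ℝ) (N : ℕ) {y : ℝ}
    (hy : (s.back N).height (s.back N).loser ≤ y) : s.bump χ N y = 0 := by
  have h := listLen_sub_height (hs N) (s.back N).loser
  rw [bump, listGraph_of_ge (fun b => (hs (N + 1)).height_pos b) _ _ (h.trans_le hy),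
    listGraph_of_ge (fun b => (hs N).height_pos b) _ _ (by simpa using hy), listLen_sub_pull hs]
  simp

theorem continuous_bump (s : SuspData A) (χ : A → ℝ) (N : ℕ) : Continuous (s.bump χ N) :=
  (continuous_listGraph _ _ _).sub (continuous_listGraph _ _ _)

theorem abs_bump_le (hs : ∀ N, (s.back N).IsSuspension) (χ : A → ℝ) (N : ℕ) (y : ℝ) :
    |s.bump χ N y| ≤ 4 * ‖s.pull χ (N + 1)‖ := by
  set m := ‖s.pull χ (N + 1)‖
  have hm : ∀ b, |s.pull χ (N + 1) b| ≤ m := norm_le_pi_norm (s.pull χ (N + 1))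
  -- One step forward adds at most one component to another. The two-letter graph and the one-letter
  -- graph are thus each at most `2 * m`.
  have hm' : ∀ b, |s.pull χ N b| ≤ 2 * m := by
    intro b
    rw [pull_eq hs]
    split_ifs
    · refine (abs_add_le _ _).trans ?_
      linarith [hm b, hm (s.back N).winner]
    · rw [add_zero]; linarith [hm b, (abs_nonneg _).trans (hm b)]
  have h1 := abs_listGraph_le (s.back (N + 1)).height hm ((s.back N).sub (s.back N).loser) y
  have h2 := abs_listGraph_le (s.back N).height hm' [(s.back N).loser] y
  have h3 : ((s.back N).sub (s.back N).loser).length = 2 := by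
    rw [sub, if_pos rfl]
    split_ifs <;> rfl
  rw [h3] at h1
  rw [bump]
  simp only [List.length_singleton, Nat.cast_one, one_mul, Nat.cast_ofNat] at h1 h2
  linarith [abs_sub (listGraph (s.back (N + 1)).height (s.pull χ (N + 1))
    ((s.back N).sub (s.back N).loser) y)
    (listGraph (s.back N).height (s.pull χ N) [(s.back N).loser] y)]

theorem continuous_wordGraph (s : SuspData A) (χ : A → ℝ) (N : ℕ) (α : A) :
    Continuous (s.wordGraph χ N α) := continuous_listGraph _ _ _

end SuspData

theorem DualRoth.exists_abs_integral_step_le (hs : DualRoth s) {η : ℝ} (hη : 0 < η) :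
    ∃ δ : ℝ, 0 < δ ∧ ∀ χ : A → ℝ, s.IsCentral χ → ∃ C : ℝ, 0 < C ∧
      ∀ (K : ℝ) (ψ : ℝ → ℝ), Continuous ψ → (∀ x, |ψ x| ≤ K) →
      (∀ x y, |ψ x - ψ y| ≤ K * |x - y| ^ η) → ∀ α, (∫ x in (0 : ℝ)..(s.height α), ψ x) = 0 →
      ∀ N : ℕ, |∫ x in (0 : ℝ)..(s.height α),
          ψ x * (s.wordGraph χ (N + 1) α x - s.wordGraph χ N α x)| ≤
        C * K * matNorm (s.B N 0) ^ (-(δ / 4) - δ / 4) := by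
  obtain ⟨δ, hδ, C₁, hC₁, h₁⟩ := hs.exists_abs_occSum_le hη
  refine ⟨δ, hδ, fun χ hχ => ?_⟩
  have hsb := hs.suspension_back
  -- Exponents add up to `δ/4 + (1 - δ) + (δ/4 - 1) = -δ/2`, from the bump, the sum over occurrences
  -- and the length of the piece.
  have hε : 0 < δ / 4 := by positivity
  obtain ⟨C₂, hC₂, h₂⟩ := exists_norm_pull_le hsb hχ hε
  obtain ⟨C₃, hC₃, h₃⟩ := hs.exists_height_le hε
  refine ⟨4 * (C₂ * 2 ^ (δ / 4)) * C₁ * C₃, by positivity, ?_⟩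
  intro K ψ hψ hψK hψη α hint N
  have hK : 0 ≤ K := (abs_nonneg _).trans (hψK 0)
  have hx := s.norm_B_pos N
  have hq := fun b => (hsb N).height_pos b
  have hlen : listLen (s.back N).height (s.word N α) = s.height α := by
    have := listLen_word_height hsb 0 N α
    rwa [Nat.zero_add] at this
  have hpull : ‖s.pull χ (N + 1)‖ ≤ C₂ * 2 ^ (δ / 4) * matNorm (s.B N 0) ^ (δ / 4) := by
    calc _ ≤ C₂ * matNorm (s.B (N + 1) 0) ^ (δ / 4) := h₂ _
      _ ≤ C₂ * (2 * matNorm (s.B N 0)) ^ (δ / 4) := by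
          gcongr
          · exact matNorm_nonneg _
          · exact s.norm_B_succ_le N
      _ = _ := by rw [Real.mul_rpow (by norm_num) hx.le, mul_assoc]
  simp only [wordGraph_succ_sub hsb]
  rw [integral_mul_occSum hq hψ (s.continuous_bump χ N) (fun y => bump_of_nonpos hsb χ N)
    (fun y => bump_of_ge hsb χ N) (s.word N α) le_rfl (by rw [zero_add, hlen])]
  set l := (s.back N).loser
  set x := matNorm (s.B N 0)
  have hbound : ∀ y ∈ uIoc (0 : ℝ) ((s.back N).height l),
      ‖s.bump χ N y * occSum (s.back N).height l (s.word N α) 0 fun u => ψ (u + y)‖ ≤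
        4 * (C₂ * 2 ^ (δ / 4) * x ^ (δ / 4)) * (C₁ * K * x ^ (1 - δ)) := by
    intro y hy
    rw [uIoc_of_le (hq l).le] at hy
    rw [norm_mul, Real.norm_eq_abs, Real.norm_eq_abs]
    refine mul_le_mul ((abs_bump_le hsb χ N y).trans (by gcongr))
      (h₁ K ψ hψ hψK hψη α hint N l y (Ioc_subset_Icc_self hy)) (abs_nonneg _) (by positivity)
  have hI := intervalIntegral.norm_integral_le_of_norm_le_const hbound
  rw [sub_zero, abs_of_pos (hq l), Real.norm_eq_abs] at hI
  calc _ ≤ _ := hI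
    _ ≤ 4 * (C₂ * 2 ^ (δ / 4) * x ^ (δ / 4)) * (C₁ * K * x ^ (1 - δ)) *
        (C₃ * x ^ (δ / 4 - 1)) := by gcongr; exact h₃ N l
    _ = 4 * (C₂ * 2 ^ (δ / 4)) * C₁ * C₃ * K *
        (x ^ (δ / 4) * x ^ (1 - δ) * x ^ (δ / 4 - 1)) := by ring
    _ = _ := by
        rw [← Real.rpow_add hx, ← Real.rpow_add hx]
        congr 2
        ring

theorem DualRoth.exists_abs_integral_sub_le (hs : DualRoth s) {η : ℝ} (hη : 0 < η) :
    ∃ δ : ℝ, 0 < δ ∧ ∀ χ : A → ℝ, s.IsCentral χ → ∃ C : ℝ, 0 < C ∧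
      ∀ (K : ℝ) (ψ : ℝ → ℝ), Continuous ψ → (∀ x, |ψ x| ≤ K) →
      (∀ x y, |ψ x - ψ y| ≤ K * |x - y| ^ η) → ∀ α, (∫ x in (0 : ℝ)..(s.height α), ψ x) = 0 →
      ∀ N M : ℕ, N ≤ M → |(∫ x in (0 : ℝ)..(s.height α), ψ x * s.wordGraph χ M α x) -
          ∫ x in (0 : ℝ)..(s.height α), ψ x * s.wordGraph χ N α x| ≤
        C * K * matNorm (s.B N 0) ^ (-δ / 4) := by
  obtain ⟨δ, hδ, h⟩ := hs.exists_abs_integral_step_le hη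
  have hε : 0 < δ / 4 := by positivity
  -- Half of the available decay `δ / 2` pays for the comparison with a telescoping difference; the
  -- other half remains in the bound.
  obtain ⟨C₁, hC₁, h₁⟩ := hs.exists_rpow_le_sub hε hε
  refine ⟨δ, hδ, fun χ hχ => ?_⟩
  obtain ⟨C₂, hC₂, h₂⟩ := h χ hχ
  refine ⟨C₂ * C₁, by positivity, ?_⟩
  intro K ψ hψ hψK hψη α hint N M hNM
  have hK : 0 ≤ K := (abs_nonneg _).trans (hψK 0)
  set a : ℕ → ℝ := fun N => ∫ x in (0 : ℝ)..(s.height α), ψ x * s.wordGraph χ N α x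
  set X : ℕ → ℝ := fun N => matNorm (s.B N 0) ^ (-(δ / 4))
  have hX : ∀ N, 0 ≤ X N := fun N => Real.rpow_nonneg (matNorm_nonneg _) _
  have hstep : ∀ N, |a (N + 1) - a N| ≤ C₂ * C₁ * K * (X N - X (N + 1)) := by
    intro N
    have hi : ∀ N, IntervalIntegrable (fun x => ψ x * s.wordGraph χ N α x) volume 0 (s.height α) :=
      fun N => (hψ.mul (s.continuous_wordGraph χ N α)).intervalIntegrable _ _
    have e : a (N + 1) - a N = ∫ x in (0 : ℝ)..(s.height α),
        ψ x * (s.wordGraph χ (N + 1) α x - s.wordGraph χ N α x) := by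
      simp only [a, mul_sub]
      rw [intervalIntegral.integral_sub (hi _) (hi _)]
    rw [e]
    calc _ ≤ C₂ * K * matNorm (s.B N 0) ^ (-(δ / 4) - δ / 4) :=
          h₂ K ψ hψ hψK hψη α hint N
      _ ≤ C₂ * K * (C₁ * (X N - X (N + 1))) := by gcongr; exact h₁ N
      _ = _ := by ring
  have hsum : |a M - a N| ≤ C₂ * C₁ * K * (X N - X M) := by
    induction M, hNM using Nat.le_induction with
    | base => simp
    | succ M _ ih =>
      have := abs_sub_le (a (M + 1)) (a M) (a N)
      linarith [hstep M]
  have e : matNorm (s.B N 0) ^ (-δ / 4) = X N := by simp only [X, neg_div]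
  rw [e]
  refine hsum.trans ?_
  gcongr
  linarith [hX M]

end RauzyVeech

end

/-! ### Hölder functions on the interval and the mean-zero graphs -/

theorem theorem5p3 {A : Type*} [Fintype A] [DecidableEq A] [Nontrivial A]
    (s : RauzyVeech.SuspData A) (hs : RauzyVeech.DualRoth s)
    (η : ℝ≥0) (hη0 : 0 < η) (hη1 : η < 1) :
    ∃ δ : ℝ, 0 < δ ∧ ∀ χ : A → ℝ, s.IsCentral χ → ∃ C : ℝ, 0 < C ∧
      ∀ len : A → ℝ, (∀ a, 0 < len a) → ∀ (α : A) (ψ : ℝ → ℝ),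
        MemHolder η ((Icc (0 : ℝ) (s.height α)).domRestrict ψ) →
        (∫ x in (0 : ℝ)..(s.height α), ψ x) = 0 →
          (∃ l : ℝ, Tendsto
            (fun N : ℕ => ∫ x in (0 : ℝ)..(s.height α), ψ x * s.OmegaGraph len χ N α x)
            atTop (𝓝 l)) ∧
          ∀ N M : ℕ, N ≤ M →
            |∫ x in (0 : ℝ)..(s.height α),
                ψ x * (s.OmegaGraph len χ M α x - s.OmegaGraph len χ N α x)| ≤
              C * RauzyVeech.holderNorm η (s.height α) ψ *
                RauzyVeech.matNorm (s.B N 0) ^ (-δ / 4) := by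
  obtain ⟨δ, hδ, h⟩ := hs.exists_abs_integral_sub_le (η := (η : ℝ)) (by exact_mod_cast hη0)
  refine ⟨δ, hδ, fun χ hχ => ?_⟩
  obtain ⟨C, hC, hbound⟩ := h χ hχ
  refine ⟨C, hC, fun len hlen α ψ hψ hint => ?_⟩
  have hq := hs.suspension.height_pos α
  obtain ⟨g, hg, hgψ, hgK, hgη⟩ := RauzyVeech.holderNorm_spec hη0 hq.le hψ
  have hgψ' : ∀ x ∈ uIcc 0 (s.height α), g x = ψ x := by
    rw [uIcc_of_le hq.le]; exact hgψ
  have hgint : (∫ x in (0 : ℝ)..(s.height α), g x) = 0 := by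
    rw [intervalIntegral.integral_congr hgψ', hint]
  -- The constant `m` normalising the mean is never needed explicitly: it disappears against a
  -- function of integral zero.
  have hOm : ∀ N, ∃ m : ℝ, ∀ x, s.OmegaGraph len χ N α x = s.wordGraph χ N α x - m := fun N =>
    ⟨_, fun x => by
      rw [RauzyVeech.SuspData.OmegaGraph,
        RauzyVeech.SuspData.sumGraph_eq hs.suspension_back hlen]; rfl⟩
  have hi : ∀ N, IntervalIntegrable (fun x => g x * s.wordGraph χ N α x) volume 0 (s.height α) :=
    fun N => (hg.mul (s.continuous_wordGraph χ N α)).intervalIntegrable _ _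
  have hic : ∀ m : ℝ, IntervalIntegrable (fun x => g x * m) volume 0 (s.height α) :=
    fun m => (hg.mul continuous_const).intervalIntegrable _ _
  have e1 : ∀ N, (∫ x in (0 : ℝ)..(s.height α), ψ x * s.OmegaGraph len χ N α x) =
      ∫ x in (0 : ℝ)..(s.height α), g x * s.wordGraph χ N α x := by
    intro N
    obtain ⟨m, hm⟩ := hOm N
    calc _ = ∫ x in (0 : ℝ)..(s.height α), (g x * s.wordGraph χ N α x - g x * m) := by
          refine intervalIntegral.integral_congr fun x hx => ?_
          simp only [hgψ' x hx, hm]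
          ring
      _ = _ := by
          rw [intervalIntegral.integral_sub (hi N) (hic m), intervalIntegral.integral_mul_const,
            hgint, zero_mul, sub_zero]
  have hb := hbound _ g hg hgK hgη α hgint
  refine ⟨?_, fun N M hNM => ?_⟩
  -- The quantitative bound itself is the Cauchy estimate, as the norms tend to infinity.
  · refine cauchySeq_tendsto_of_complete (cauchySeq_of_le_tendsto_0' (fun N => C *
      RauzyVeech.holderNorm η (s.height α) ψ * RauzyVeech.matNorm (s.B N 0) ^ (-(δ / 4)))
        (fun N M hNM => ?_) ?_)
    · rw [dist_comm, Real.dist_eq, e1, e1, ← neg_div]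
      exact hb N M hNM
    · have := (tendsto_rpow_neg_atTop (by positivity : 0 < δ / 4)).comp s.tendsto_norm_B
      simpa using this.const_mul (C * RauzyVeech.holderNorm η (s.height α) ψ)
  · refine le_trans (le_of_eq ?_) (hb N M hNM)
    obtain ⟨m, hm⟩ := hOm N
    obtain ⟨m', hm'⟩ := hOm M
    congr 1
    calc _ = ∫ x in (0 : ℝ)..(s.height α),
          (g x * s.wordGraph χ M α x - g x * s.wordGraph χ N α x - g x * (m' - m)) := by
          refine intervalIntegral.integral_congr fun x hx => ?_
          simp only [hgψ' x hx, hm, hm']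
          ring
      _ = _ := by
          rw [intervalIntegral.integral_sub ((hi M).sub (hi N)) (hic _),
            intervalIntegral.integral_sub (hi M) (hi N), intervalIntegral.integral_mul_const,
            hgint, zero_mul, sub_zero]
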